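/- Let $\mathfrak{C}^*$ be the category of (not necessarily unital) complex $C^*$-algebras and $*$-homomorphisms, and let $\mathrm{Ab}$ be the category of abelian groups. Let $E\colon \mathfrak{C}^*\to\mathrm{Ab}$ be a functor such that 1. $E$ is $M_2$-stable: for every $C^*$-algebra $A$, the upper left corner inclusion $\iota_A\colon A\to M_2(A)$, $\iota_A(a)=\mathrm{diag}(a,0)$, is sent to an isomorphism $E(\iota_A)$; 2. $E$ is split exact: for every short exact sequence $0\to J\to A\to B\to 0$ of $C^*$-algebras for which $A\to B$ has a right inverse $B\to A$ that is a $*$-homomorphism, the sequence $0\to E(J)\to E(A)\to E(B)\to 0$ is exact. Let $\mathcal O$ be a properly infinite $C^*$-algebra, that is, a unital $C^*$-algebra containing elements $s,t$ with $s^*s=t^*t=1$ and $s^*t=0$. Let $\underline\otimes$ denote the spatial (minimal) tensor product of $C^*$-algebras. Then the functor $A\mapsto E(A\,\underline\otimes\,\mathcal O)$ (which sends $\varphi$ to $E(\varphi\,\underline\otimes\,\mathrm{id}_{\mathcal O})$) is homotopy invariant: whenever two $*$-homomorphisms $\varphi_0,\varphi_1\colon A\to B$ of $C^*$-algebras are homotopic,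 i.e. are joined by a family of $*$-homomorphisms $\varphi_t\colon A\to B$, $t\in[0,1]$, with $t\mapsto\varphi_t(a)$ norm continuous for each $a\in A$, one has $E(\varphi_0\,\underline\otimes\,\mathrm{id}_{\mathcal O})=E(\varphi_1\,\underline\otimes\,\mathrm{id}_{\mathcal O})$. -/

import Mathlib

open scoped TensorProduct
open CategoryTheory UniformSpace

universe u v

noncomputable section

/-! ### Tensor products of Hilbert spaces and of operators -/

/-- The Hilbert space tensor product: the completion of the algebraic tensor product with respect
to the inner product `⟪ξ ⊗ η, ξ' ⊗ η'⟫ = ⟪ξ, ξ'⟫ * ⟪η, η'⟫`. -/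
def HilbertTensor (H K : Type u) [NormedAddCommGroup H] [InnerProductSpace ℂ H]
    [NormedAddCommGroup K] [InnerProductSpace ℂ K] : Type u :=
  Completion (H ⊗[ℂ] K)

namespace HilbertTensor

variable {H K : Type u} [NormedAddCommGroup H] [InnerProductSpace ℂ H]
  [NormedAddCommGroup K] [InnerProductSpace ℂ K]

instance : NormedAddCommGroup (HilbertTensor H K) :=
  inferInstanceAs (NormedAddCommGroup (Completion (H ⊗[ℂ] K)))
instance : InnerProductSpace ℂ (HilbertTensor H K) :=
  inferInstanceAs (InnerProductSpace ℂ (Completion (H ⊗[ℂ] K)))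
instance : CompleteSpace (HilbertTensor H K) :=
  inferInstanceAs (CompleteSpace (Completion (H ⊗[ℂ] K)))

/-- The isometric inclusion of the algebraic tensor product. -/
def incl : H ⊗[ℂ] K →ₗᵢ[ℂ] HilbertTensor H K :=
  (Completion.toComplₗᵢ : H ⊗[ℂ] K →ₗᵢ[ℂ] Completion (H ⊗[ℂ] K))

theorem denseRange_incl : DenseRange (incl : H ⊗[ℂ] K → HilbertTensor H K) :=
  Completion.denseRange_coe

/-- The bounded operator `S ⊗ T`, given by `(S ⊗ T)(ξ ⊗ η) = S ξ ⊗ T η`. -/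
def map (S : H →L[ℂ] H) (T : K →L[ℂ] K) : HilbertTensor H K →L[ℂ] HilbertTensor H K :=
  (TensorProduct.mapL S T).completion

theorem map_incl (S : H →L[ℂ] H) (T : K →L[ℂ] K) (v : H ⊗[ℂ] K) :
    map S T (incl v) = incl (TensorProduct.mapL S T v) :=
  ContinuousLinearMap.completion_apply_coe _ v

theorem ext_incl {S T : HilbertTensor H K →L[ℂ] HilbertTensor H K}
    (h : ∀ v, S (incl v) = T (incl v)) : S = T :=
  ContinuousLinearMap.coeFn_injective <|
    denseRange_incl.equalizer S.continuous T.continuous (funext h)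

theorem norm_map_le (S : H →L[ℂ] H) (T : K →L[ℂ] K) : ‖map S T‖ ≤ ‖S‖ * ‖T‖ := by
  refine ContinuousLinearMap.opNorm_le_bound _ (by positivity) fun v => ?_
  refine denseRange_incl.induction_on (p := fun v => ‖map S T v‖ ≤ ‖S‖ * ‖T‖ * ‖v‖) v
    (isClosed_le (by fun_prop) (by fun_prop)) fun w => ?_
  rw [map_incl, LinearIsometry.norm_map, LinearIsometry.norm_map]
  exact ContinuousLinearMap.le_of_opNorm_le _ (TensorProduct.norm_mapL_le S T) w

theorem star_map [CompleteSpace H] [CompleteSpace K] (S : H →L[ℂ] H) (T : K →L[ℂ] K) :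
    star (map S T) = map (star S) (star T) := by
  symm
  rw [ContinuousLinearMap.star_eq_adjoint (map S T), ContinuousLinearMap.eq_adjoint_iff]
  intro x y
  refine denseRange_incl.induction_on₂
    (p := fun x y => inner ℂ (map (star S) (star T) x) y = inner ℂ x (map S T y))
    (isClosed_eq (by fun_prop) (by fun_prop)) (fun v w => ?_) x y
  rw [map_incl, map_incl, LinearIsometry.inner_map_map, LinearIsometry.inner_map_map]
  induction v with
  | zero => simp
  | add v v' hv hv' => simp only [_root_.map_add, inner_add_left, hv, hv']
  | tmul ξ η =>
    induction w with
    | zero => simp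
    | add w w' hw hw' => simp only [_root_.map_add, inner_add_right, hw, hw']
    | tmul ξ' η' =>
      simp only [TensorProduct.mapL_tmul, TensorProduct.inner_tmul,
        ContinuousLinearMap.star_eq_adjoint, ContinuousLinearMap.adjoint_inner_left]

end HilbertTensor

/-! ### Representations and the spatial norm on the algebraic tensor product -/

/-- A `⋆`-representation of a C⋆-algebra on a Hilbert space (no nondegeneracy or faithfulness
is required). -/
structure HilbertRep (A : Type u) [NonUnitalCStarAlgebra A] : Type (u + 1) where
  /-- the Hilbert space -/
  H : Type u
  [instNormed : NormedAddCommGroup H]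
  [instInner : InnerProductSpace ℂ H]
  [instComplete : CompleteSpace H]
  /-- the action by bounded operators -/
  π : A →⋆ₙₐ[ℂ] (H →L[ℂ] H)

attribute [instance] HilbertRep.instNormed HilbertRep.instInner HilbertRep.instComplete

namespace HilbertRep

variable {A A' B B' : Type u} [NonUnitalCStarAlgebra A] [NonUnitalCStarAlgebra A']
  [NonUnitalCStarAlgebra B] [NonUnitalCStarAlgebra B']

/-- Pulling back a representation along a `⋆`-homomorphism. -/
def comap (φ : A →⋆ₙₐ[ℂ] A') (ρ : HilbertRep A') : HilbertRep A where
  H := ρ.H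
  π := ρ.π.comp φ

/-- The linear map underlying `tensor`. -/
def tensorLin (ρ : HilbertRep A) (σ : HilbertRep B) :
    A ⊗[ℂ] B →ₗ[ℂ] (HilbertTensor ρ.H σ.H →L[ℂ] HilbertTensor ρ.H σ.H) :=
  TensorProduct.lift <| LinearMap.mk₂ ℂ (fun a b => HilbertTensor.map (ρ.π a) (σ.π b))
    (fun a a' b => HilbertTensor.ext_incl fun v => by
      simp [HilbertTensor.map_incl, TensorProduct.map_add_left])
    (fun c a b => HilbertTensor.ext_incl fun v => by
      simp [HilbertTensor.map_incl, TensorProduct.map_smul_left])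
    (fun a b b' => HilbertTensor.ext_incl fun v => by
      simp [HilbertTensor.map_incl, TensorProduct.map_add_right])
    (fun c a b => HilbertTensor.ext_incl fun v => by
      simp [HilbertTensor.map_incl, TensorProduct.map_smul_right])

/-- The representation `π ⊗ σ` of the algebraic tensor product on the Hilbert space tensor product,
given by `a ⊗ b ↦ π(a) ⊗ σ(b)`. -/
def tensor (ρ : HilbertRep A) (σ : HilbertRep B) :
    A ⊗[ℂ] B →⋆ₙₐ[ℂ] (HilbertTensor ρ.H σ.H →L[ℂ] HilbertTensor ρ.H σ.H) where
  toFun := tensorLin ρ σ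
  map_smul' := map_smul (tensorLin ρ σ)
  map_zero' := map_zero (tensorLin ρ σ)
  map_add' := map_add (tensorLin ρ σ)
  map_mul' x y := by
    induction x with
    | zero => simp
    | add x x' hx hx' => rw [add_mul, map_add, map_add, add_mul, hx, hx']
    | tmul a b =>
      induction y with
      | zero => simp
      | add y y' hy hy' => rw [mul_add, map_add, map_add, mul_add, hy, hy']
      | tmul a' b' =>
        refine HilbertTensor.ext_incl fun v => ?_
        simp only [Algebra.TensorProduct.tmul_mul_tmul, tensorLin, TensorProduct.lift.tmul,
          LinearMap.mk₂_apply, map_mul, mul_apply_eq_comp, HilbertTensor.map_incl,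
          TensorProduct.mapL_mul]
  map_star' x := by
    induction x with
    | zero => simp
    | add x x' hx hx' => rw [star_add, map_add, map_add, star_add, hx, hx']
    | tmul a b =>
      simp only [TensorProduct.star_tmul, tensorLin, TensorProduct.lift.tmul,
        LinearMap.mk₂_apply, map_star, HilbertTensor.star_map]

theorem tensor_tmul (ρ : HilbertRep A) (σ : HilbertRep B) (a : A) (b : B) :
    ρ.tensor σ (a ⊗ₜ b) = HilbertTensor.map (ρ.π a) (σ.π b) := rfl

theorem tensor_map (φ : A →⋆ₙₐ[ℂ] A') (ψ : B →⋆ₙₐ[ℂ] B') (ρ : HilbertRep A')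
    (σ : HilbertRep B') (x : A ⊗[ℂ] B) :
    ρ.tensor σ (TensorProduct.map (φ : A →ₗ[ℂ] A') (ψ : B →ₗ[ℂ] B') x)
      = (ρ.comap φ).tensor (σ.comap ψ) x := by
  induction x with
  | zero => rw [map_zero, map_zero, map_zero]; rfl
  | add x y hx hy => rw [map_add, map_add, map_add, hx, hy]; rfl
  | tmul a b => rfl

end HilbertRep

/-- The algebraic tensor product `A ⊙ B` of two C⋆-algebras, as a type that will carry the spatial
C⋆-norm. -/
def AlgTensor (A B : Type u) [NonUnitalCStarAlgebra A] [NonUnitalCStarAlgebra B] : Type u :=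
  A ⊗[ℂ] B

namespace AlgTensor

variable {A A' A'' B B' : Type u} [NonUnitalCStarAlgebra A] [NonUnitalCStarAlgebra A']
  [NonUnitalCStarAlgebra A''] [NonUnitalCStarAlgebra B] [NonUnitalCStarAlgebra B']

instance : NonUnitalRing (AlgTensor A B) := inferInstanceAs (NonUnitalRing (A ⊗[ℂ] B))
instance : Module ℂ (AlgTensor A B) := inferInstanceAs (Module ℂ (A ⊗[ℂ] B))
instance : IsScalarTower ℂ (AlgTensor A B) (AlgTensor A B) :=
  inferInstanceAs (IsScalarTower ℂ (A ⊗[ℂ] B) (A ⊗[ℂ] B))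
instance : SMulCommClass ℂ (AlgTensor A B) (AlgTensor A B) :=
  inferInstanceAs (SMulCommClass ℂ (A ⊗[ℂ] B) (A ⊗[ℂ] B))
instance : StarRing (AlgTensor A B) := inferInstanceAs (StarRing (A ⊗[ℂ] B))
instance : StarModule ℂ (AlgTensor A B) := inferInstanceAs (StarModule ℂ (A ⊗[ℂ] B))

/-- The elementary tensor `a ⊗ b` in `A ⊙ B`. -/
def tmul (a : A) (b : B) : AlgTensor A B := a ⊗ₜ[ℂ] b

/-- The representation `π ⊗ σ` of `A ⊙ B`. -/
def rep (p : HilbertRep A × HilbertRep B) :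
    AlgTensor A B →⋆ₙₐ[ℂ] (HilbertTensor p.1.H p.2.H →L[ℂ] HilbertTensor p.1.H p.2.H) :=
  p.1.tensor p.2

/-- The spatial (minimal) norm: the supremum of `‖(π ⊗ σ)(x)‖` over all representations `π` of `A`
and `σ` of `B`. -/
def spatialNorm (x : AlgTensor A B) : ℝ := ⨆ p : HilbertRep A × HilbertRep B, ‖rep p x‖

theorem bddAbove_norm_rep (x : AlgTensor A B) :
    BddAbove (Set.range fun p : HilbertRep A × HilbertRep B => ‖rep p x‖) := by
  suffices h : ∃ C, ∀ p : HilbertRep A × HilbertRep B, ‖rep p x‖ ≤ C by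
    obtain ⟨C, hC⟩ := h
    exact ⟨C, by rintro _ ⟨p, rfl⟩; exact hC p⟩
  induction x using TensorProduct.induction_on with
  | zero => exact ⟨0, fun p => ((congrArg norm (map_zero (rep p))).trans norm_zero).le⟩
  | add x y hx hy =>
    obtain ⟨C, hC⟩ := hx
    obtain ⟨D, hD⟩ := hy
    exact ⟨C + D, fun p => (congrArg norm (map_add (rep p) x y)).trans_le <|
      (norm_add_le _ _).trans (add_le_add (hC p) (hD p))⟩
  | tmul a b =>
    refine ⟨‖a‖ * ‖b‖, fun p => (HilbertTensor.norm_map_le (p.1.π a) (p.2.π b)).trans ?_⟩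
    gcongr
    · exact NonUnitalStarAlgHom.norm_apply_le p.1.π a
    · exact NonUnitalStarAlgHom.norm_apply_le p.2.π b

theorem norm_rep_le (p : HilbertRep A × HilbertRep B) (x : AlgTensor A B) :
    ‖rep p x‖ ≤ spatialNorm x :=
  le_ciSup (bddAbove_norm_rep x) p

theorem spatialNorm_le {x : AlgTensor A B} {C : ℝ} (hC : 0 ≤ C)
    (h : ∀ p : HilbertRep A × HilbertRep B, ‖rep p x‖ ≤ C) : spatialNorm x ≤ C :=
  Real.iSup_le h hC

theorem spatialNorm_nonneg (x : AlgTensor A B) : 0 ≤ spatialNorm x :=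
  Real.iSup_nonneg fun _ => norm_nonneg _

/-- The spatial norm as a ring seminorm. -/
def spatialSeminorm (A B : Type u) [NonUnitalCStarAlgebra A] [NonUnitalCStarAlgebra B] :
    RingSeminorm (AlgTensor A B) where
  toFun := spatialNorm
  map_zero' := le_antisymm (spatialNorm_le le_rfl fun p => by simp) (spatialNorm_nonneg _)
  add_le' x y := spatialNorm_le (add_nonneg (spatialNorm_nonneg _) (spatialNorm_nonneg _))
    fun p => by
      rw [map_add]
      exact (norm_add_le _ _).trans (add_le_add (norm_rep_le p x) (norm_rep_le p y))
  neg' x := iSup_congr fun p => by rw [map_neg, norm_neg]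
  mul_le' x y := spatialNorm_le (mul_nonneg (spatialNorm_nonneg _) (spatialNorm_nonneg _))
    fun p => by
      rw [map_mul]
      exact (norm_mul_le _ _).trans <| mul_le_mul (norm_rep_le p x) (norm_rep_le p y)
        (norm_nonneg _) (spatialNorm_nonneg _)

instance : NonUnitalSeminormedRing (AlgTensor A B) :=
  { (inferInstance : NonUnitalRing (AlgTensor A B)),
    (spatialSeminorm A B).toAddGroupSeminorm.toSeminormedAddCommGroup with
    norm_mul_le := (spatialSeminorm A B).mul_le' }

theorem norm_eq (x : AlgTensor A B) : ‖x‖ = spatialNorm x := rfl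

instance : NormedSpace ℂ (AlgTensor A B) where
  __ := (inferInstance : Module ℂ (AlgTensor A B))
  norm_smul_le c x := spatialNorm_le (mul_nonneg (norm_nonneg _) (spatialNorm_nonneg _))
    fun p => by
      rw [map_smul]
      exact (norm_smul_le _ _).trans
        (mul_le_mul_of_nonneg_left (norm_rep_le p x) (norm_nonneg _))

instance : NormedStarGroup (AlgTensor A B) where
  norm_star_le x := spatialNorm_le (spatialNorm_nonneg _) fun p => by
    rw [map_star, norm_star]; exact norm_rep_le p x

theorem norm_mul_self_le (x : AlgTensor A B) : ‖x‖ * ‖x‖ ≤ ‖star x * x‖ := by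
  have h : ‖x‖ ≤ Real.sqrt ‖star x * x‖ := spatialNorm_le (Real.sqrt_nonneg _) fun p =>
    Real.le_sqrt_of_sq_le <| by
      rw [pow_two, ← CStarRing.norm_star_mul_self, ← map_star, ← map_mul]
      exact norm_rep_le p (star x * x)
  exact (mul_self_le_mul_self (norm_nonneg x) h).trans_eq (Real.mul_self_sqrt (norm_nonneg _))

/-- The `⋆`-homomorphism `φ ⊙ ψ` on algebraic tensor products. -/
def map (φ : A →⋆ₙₐ[ℂ] A') (ψ : B →⋆ₙₐ[ℂ] B') : AlgTensor A B →⋆ₙₐ[ℂ] AlgTensor A' B' where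
  toFun x := TensorProduct.map (φ : A →ₗ[ℂ] A') (ψ : B →ₗ[ℂ] B') x
  map_smul' c x := map_smul (TensorProduct.map (φ : A →ₗ[ℂ] A') (ψ : B →ₗ[ℂ] B')) c x
  map_zero' := map_zero (TensorProduct.map (φ : A →ₗ[ℂ] A') (ψ : B →ₗ[ℂ] B'))
  map_add' := map_add (TensorProduct.map (φ : A →ₗ[ℂ] A') (ψ : B →ₗ[ℂ] B'))
  map_mul' := by
    suffices h : ∀ x y : A ⊗[ℂ] B,
        TensorProduct.map (φ : A →ₗ[ℂ] A') (ψ : B →ₗ[ℂ] B') (x * y)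
        = TensorProduct.map (φ : A →ₗ[ℂ] A') (ψ : B →ₗ[ℂ] B') x
          * TensorProduct.map (φ : A →ₗ[ℂ] A') (ψ : B →ₗ[ℂ] B') y from h
    intro x y
    induction x with
    | zero => simp
    | add x x' hx hx' => simp only [add_mul, map_add, hx, hx']
    | tmul a b =>
      induction y with
      | zero => simp
      | add y y' hy hy' => simp only [mul_add, map_add, hy, hy']
      | tmul a' b' => simp
  map_star' := by
    suffices h : ∀ x : A ⊗[ℂ] B,
        TensorProduct.map (φ : A →ₗ[ℂ] A') (ψ : B →ₗ[ℂ] B') (star x)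
        = star (TensorProduct.map (φ : A →ₗ[ℂ] A') (ψ : B →ₗ[ℂ] B') x) from h
    intro x
    induction x with
    | zero => simp
    | add x x' hx hx' => simp only [star_add, map_add, hx, hx']
    | tmul a b => simp [map_star]

theorem norm_map_le (φ : A →⋆ₙₐ[ℂ] A') (ψ : B →⋆ₙₐ[ℂ] B') (x : AlgTensor A B) :
    ‖map φ ψ x‖ ≤ ‖x‖ :=
  spatialNorm_le (spatialNorm_nonneg _) fun p =>
    (congrArg norm (HilbertRep.tensor_map φ ψ p.1 p.2 x)).trans_le
      (norm_rep_le (p.1.comap φ, p.2.comap ψ) x)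

theorem uniformContinuous_map (φ : A →⋆ₙₐ[ℂ] A') (ψ : B →⋆ₙₐ[ℂ] B') :
    UniformContinuous (map φ ψ) :=
  uniformContinuous_addMonoidHom_of_continuous <|
    AddMonoidHomClass.continuous_of_bound (map φ ψ) 1 fun x => by
      simpa using norm_map_le φ ψ x

theorem map_id (x : AlgTensor A B) :
    map (NonUnitalStarAlgHom.id ℂ A) (NonUnitalStarAlgHom.id ℂ B) x = x := by
  induction x using TensorProduct.induction_on with
  | zero => exact map_zero (map (NonUnitalStarAlgHom.id ℂ A) (NonUnitalStarAlgHom.id ℂ B))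
  | add x y hx hy =>
    exact (map_add (map (NonUnitalStarAlgHom.id ℂ A) (NonUnitalStarAlgHom.id ℂ B)) x y).trans
      (congrArg₂ (· + ·) hx hy)
  | tmul a b => rfl

theorem map_comp_left (φ : A →⋆ₙₐ[ℂ] A') (φ' : A' →⋆ₙₐ[ℂ] A'') (x : AlgTensor A B) :
    map (φ'.comp φ) (NonUnitalStarAlgHom.id ℂ B) x
      = map φ' (NonUnitalStarAlgHom.id ℂ B) (map φ (NonUnitalStarAlgHom.id ℂ B) x) := by
  induction x using TensorProduct.induction_on with
  | zero =>
    exact (map_zero (map (φ'.comp φ) (NonUnitalStarAlgHom.id ℂ B))).trans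
      (map_zero ((map φ' (NonUnitalStarAlgHom.id ℂ B)).comp
        (map φ (NonUnitalStarAlgHom.id ℂ B)))).symm
  | add x y hx hy =>
    exact ((map_add (map (φ'.comp φ) (NonUnitalStarAlgHom.id ℂ B)) x y).trans
      (congrArg₂ (· + ·) hx hy)).trans
      (map_add ((map φ' (NonUnitalStarAlgHom.id ℂ B)).comp
        (map φ (NonUnitalStarAlgHom.id ℂ B))) x y).symm
  | tmul a b => rfl

end AlgTensor

/-! ### The spatial tensor product -/

/-- The spatial tensor product of two C⋆-algebras: the completion of the algebraic tensor product
with respect to the spatial norm. -/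
def SpatialTensor (A B : Type u) [NonUnitalCStarAlgebra A] [NonUnitalCStarAlgebra B] : Type u :=
  Completion (AlgTensor A B)

namespace SpatialTensor

variable {A A' A'' B B' : Type u} [NonUnitalCStarAlgebra A] [NonUnitalCStarAlgebra A']
  [NonUnitalCStarAlgebra A''] [NonUnitalCStarAlgebra B] [NonUnitalCStarAlgebra B']

instance : NormedAddCommGroup (SpatialTensor A B) :=
  inferInstanceAs (NormedAddCommGroup (Completion (AlgTensor A B)))
instance : NormedSpace ℂ (SpatialTensor A B) :=
  inferInstanceAs (NormedSpace ℂ (Completion (AlgTensor A B)))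
instance : CompleteSpace (SpatialTensor A B) :=
  inferInstanceAs (CompleteSpace (Completion (AlgTensor A B)))

/-- The canonical map from the algebraic tensor product. -/
def ofAlg : AlgTensor A B →L[ℂ] SpatialTensor A B :=
  (Completion.toComplL : AlgTensor A B →L[ℂ] Completion (AlgTensor A B))

/-- The elementary tensor `a ⊗ b`. -/
def tmul (a : A) (b : B) : SpatialTensor A B := ofAlg (AlgTensor.tmul a b)

theorem norm_ofAlg (x : AlgTensor A B) : ‖(ofAlg x : SpatialTensor A B)‖ = ‖x‖ :=
  Completion.norm_coe x

theorem denseRange_ofAlg : DenseRange (ofAlg : AlgTensor A B → SpatialTensor A B) :=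
  Completion.denseRange_coe

theorem isDenseInducing_ofAlg : IsDenseInducing (ofAlg : AlgTensor A B → SpatialTensor A B) :=
  Completion.isDenseInducing_coe

@[elab_as_elim]
theorem induction_on {p : SpatialTensor A B → Prop} (x : SpatialTensor A B)
    (hp : IsClosed {x | p x}) (ih : ∀ x : AlgTensor A B, p (ofAlg x)) : p x :=
  Completion.induction_on x hp ih

/-- The product extends that of the algebraic tensor product by continuity. -/
instance : Mul (SpatialTensor A B) where
  mul x y := (isDenseInducing_ofAlg.prodMap isDenseInducing_ofAlg).extend
    (fun p : AlgTensor A B × AlgTensor A B => (ofAlg (p.1 * p.2) : SpatialTensor A B)) (x, y)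

/-- The involution extends that of the algebraic tensor product by continuity. -/
instance : Star (SpatialTensor A B) where
  star := Completion.map (star : AlgTensor A B → AlgTensor A B)

theorem ofAlg_mul (x y : AlgTensor A B) :
    (ofAlg (x * y) : SpatialTensor A B) = ofAlg x * ofAlg y :=
  ((isDenseInducing_ofAlg.prodMap isDenseInducing_ofAlg).extend_eq
    (f := fun p : AlgTensor A B × AlgTensor A B => (ofAlg (p.1 * p.2) : SpatialTensor A B))
    (ofAlg.continuous.comp continuous_mul) (x, y)).symm

theorem uniformContinuous_star_alg : UniformContinuous (star : AlgTensor A B → AlgTensor A B) :=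
  uniformContinuous_addMonoidHom_of_continuous
    (f := (starAddEquiv : AlgTensor A B ≃+ AlgTensor A B).toAddMonoidHom) continuous_star

theorem ofAlg_star (x : AlgTensor A B) :
    (ofAlg (star x) : SpatialTensor A B) = star (ofAlg x) :=
  (Completion.map_coe uniformContinuous_star_alg x).symm

instance : ContinuousMul (SpatialTensor A B) where
  continuous_mul := by
    let m : AlgTensor A B →+ AlgTensor A B →+ SpatialTensor A B :=
      (AddMonoidHom.mul : AlgTensor A B →+ AlgTensor A B →+ AlgTensor A B).compr₂
        (ofAlg : AlgTensor A B →L[ℂ] SpatialTensor A B).toLinearMap.toAddMonoidHom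
    have hm : Continuous fun p : AlgTensor A B × AlgTensor A B => m p.1 p.2 :=
      ofAlg.continuous.comp continuous_mul
    have di : IsDenseInducing ((ofAlg : AlgTensor A B →L[ℂ] SpatialTensor A B)
      |>.toLinearMap.toAddMonoidHom) := isDenseInducing_ofAlg
    exact (di.extend_Z_bilin di hm :)

instance : ContinuousStar (SpatialTensor A B) where
  continuous_star := Completion.continuous_map

theorem zero_mul' (x : SpatialTensor A B) : 0 * x = 0 := by
  induction x using induction_on with
  | hp => exact isClosed_eq (by fun_prop) (by fun_prop)
  | ih x => rw [← map_zero ofAlg, ← ofAlg_mul, zero_mul]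

theorem mul_zero' (x : SpatialTensor A B) : x * 0 = 0 := by
  induction x using induction_on with
  | hp => exact isClosed_eq (by fun_prop) (by fun_prop)
  | ih x => rw [← map_zero ofAlg, ← ofAlg_mul, mul_zero]

theorem mul_assoc' (x y z : SpatialTensor A B) : x * y * z = x * (y * z) := by
  induction x using induction_on with
  | hp =>
    exact isClosed_eq ((continuous_id.mul continuous_const).mul continuous_const)
      (continuous_id.mul continuous_const)
  | ih x =>
  induction y using induction_on with
  | hp =>
    exact isClosed_eq ((continuous_const.mul continuous_id).mul continuous_const)
      (continuous_const.mul (continuous_id.mul continuous_const))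
  | ih y =>
  induction z using induction_on with
  | hp =>
    exact isClosed_eq (continuous_const.mul continuous_id)
      (continuous_const.mul (continuous_const.mul continuous_id))
  | ih z => rw [← ofAlg_mul, ← ofAlg_mul, ← ofAlg_mul, ← ofAlg_mul, mul_assoc]

theorem mul_add' (x y z : SpatialTensor A B) : x * (y + z) = x * y + x * z := by
  induction x using induction_on with
  | hp => exact isClosed_eq (by fun_prop) (by fun_prop)
  | ih x =>
  induction y using induction_on with
  | hp => exact isClosed_eq (by fun_prop) (by fun_prop)
  | ih y =>
  induction z using induction_on with
  | hp => exact isClosed_eq (by fun_prop) (by fun_prop)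
  | ih z => rw [← map_add, ← ofAlg_mul, ← ofAlg_mul, ← ofAlg_mul, ← map_add, mul_add]

theorem add_mul' (x y z : SpatialTensor A B) : (x + y) * z = x * z + y * z := by
  induction x using induction_on with
  | hp => exact isClosed_eq (by fun_prop) (by fun_prop)
  | ih x =>
  induction y using induction_on with
  | hp => exact isClosed_eq (by fun_prop) (by fun_prop)
  | ih y =>
  induction z using induction_on with
  | hp => exact isClosed_eq (by fun_prop) (by fun_prop)
  | ih z => rw [← map_add, ← ofAlg_mul, ← ofAlg_mul, ← ofAlg_mul, ← map_add, add_mul]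

theorem norm_mul_le' (x y : SpatialTensor A B) : ‖x * y‖ ≤ ‖x‖ * ‖y‖ := by
  induction x using induction_on with
  | hp => exact isClosed_le (by fun_prop) (by fun_prop)
  | ih x =>
  induction y using induction_on with
  | hp => exact isClosed_le (by fun_prop) (by fun_prop)
  | ih y => simpa only [← ofAlg_mul, norm_ofAlg] using norm_mul_le x y

theorem star_star' (x : SpatialTensor A B) : star (star x) = x := by
  induction x using induction_on with
  | hp => exact isClosed_eq (by fun_prop) (by fun_prop)
  | ih x => rw [← ofAlg_star, ← ofAlg_star, star_star]

theorem star_mul' (x y : SpatialTensor A B) : star (x * y) = star y * star x := by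
  induction x using induction_on with
  | hp => exact isClosed_eq (by fun_prop) (by fun_prop)
  | ih x =>
  induction y using induction_on with
  | hp => exact isClosed_eq (by fun_prop) (by fun_prop)
  | ih y => rw [← ofAlg_mul, ← ofAlg_star, ← ofAlg_star, ← ofAlg_star, ← ofAlg_mul, star_mul]

theorem star_add' (x y : SpatialTensor A B) : star (x + y) = star x + star y := by
  induction x using induction_on with
  | hp => exact isClosed_eq (by fun_prop) (by fun_prop)
  | ih x =>
  induction y using induction_on with
  | hp => exact isClosed_eq (by fun_prop) (by fun_prop)
  | ih y => rw [← map_add, ← ofAlg_star, ← ofAlg_star, ← ofAlg_star, ← map_add, star_add]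

theorem star_smul' (c : ℂ) (x : SpatialTensor A B) : star (c • x) = star c • star x := by
  induction x using induction_on with
  | hp =>
    exact isClosed_eq ((continuous_id.const_smul c).star)
      (continuous_id.star.const_smul (star c))
  | ih x => rw [← map_smul, ← ofAlg_star, ← ofAlg_star, ← map_smul, star_smul]

theorem smul_mul' (c : ℂ) (x y : SpatialTensor A B) : c • x * y = c • (x * y) := by
  induction x using induction_on with
  | hp =>
    exact isClosed_eq ((continuous_id.const_smul c).mul continuous_const)
      ((continuous_id.mul continuous_const).const_smul c)
  | ih x =>
  induction y using induction_on with
  | hp =>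
    exact isClosed_eq (continuous_const.mul continuous_id)
      ((continuous_const.mul continuous_id).const_smul c)
  | ih y => rw [← map_smul, ← ofAlg_mul, ← ofAlg_mul, ← map_smul, smul_mul_assoc]

theorem mul_smul' (c : ℂ) (x y : SpatialTensor A B) : c • (x * y) = x * c • y := by
  induction x using induction_on with
  | hp =>
    exact isClosed_eq ((continuous_id.mul continuous_const).const_smul c)
      (continuous_id.mul continuous_const)
  | ih x =>
  induction y using induction_on with
  | hp =>
    exact isClosed_eq ((continuous_const.mul continuous_id).const_smul c)
      (continuous_const.mul (continuous_id.const_smul c))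
  | ih y => rw [← map_smul, ← ofAlg_mul, ← ofAlg_mul, ← map_smul, mul_smul_comm]

theorem norm_mul_self_le' (x : SpatialTensor A B) : ‖x‖ * ‖x‖ ≤ ‖star x * x‖ := by
  induction x using induction_on with
  | hp => exact isClosed_le (by fun_prop) (by fun_prop)
  | ih x =>
    simpa only [← ofAlg_mul, ← ofAlg_star, norm_ofAlg] using AlgTensor.norm_mul_self_le x

instance : NonUnitalNormedRing (SpatialTensor A B) where
  __ := (inferInstance : NormedAddCommGroup (SpatialTensor A B))
  __ := (inferInstance : Mul (SpatialTensor A B))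
  zero_mul := zero_mul'
  mul_zero := mul_zero'
  mul_assoc := mul_assoc'
  left_distrib := mul_add'
  right_distrib := add_mul'
  norm_mul_le := norm_mul_le'

instance : StarRing (SpatialTensor A B) where
  star_involutive := star_star'
  star_mul := star_mul'
  star_add := star_add'

instance : NonUnitalCStarAlgebra (SpatialTensor A B) where
  __ := (inferInstance : NonUnitalNormedRing (SpatialTensor A B))
  __ := (inferInstance : StarRing (SpatialTensor A B))
  __ := (inferInstance : NormedSpace ℂ (SpatialTensor A B))
  __ := (inferInstance : CompleteSpace (SpatialTensor A B))
  smul_assoc := smul_mul'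
  smul_comm := mul_smul'
  star_smul := star_smul'
  norm_mul_self_le := norm_mul_self_le'

/-- The map underlying `map`. -/
def mapFun (φ : A →⋆ₙₐ[ℂ] A') (ψ : B →⋆ₙₐ[ℂ] B') (x : SpatialTensor A B) :
    SpatialTensor A' B' :=
  Completion.map (AlgTensor.map φ ψ) x

theorem continuous_mapFun (φ : A →⋆ₙₐ[ℂ] A') (ψ : B →⋆ₙₐ[ℂ] B') : Continuous (mapFun φ ψ) :=
  Completion.continuous_map

theorem mapFun_ofAlg (φ : A →⋆ₙₐ[ℂ] A') (ψ : B →⋆ₙₐ[ℂ] B') (x : AlgTensor A B) :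
    mapFun φ ψ (ofAlg x) = ofAlg (AlgTensor.map φ ψ x) :=
  Completion.map_coe (AlgTensor.uniformContinuous_map φ ψ) x

theorem mapFun_smul (φ : A →⋆ₙₐ[ℂ] A') (ψ : B →⋆ₙₐ[ℂ] B') (c : ℂ) (x : SpatialTensor A B) :
    mapFun φ ψ (c • x) = c • mapFun φ ψ x := by
  induction x using induction_on with
  | hp =>
    exact isClosed_eq ((continuous_mapFun φ ψ).comp (continuous_id.const_smul c))
      ((continuous_mapFun φ ψ).const_smul c)
  | ih x => rw [← map_smul, mapFun_ofAlg, mapFun_ofAlg, map_smul, map_smul]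

theorem mapFun_add (φ : A →⋆ₙₐ[ℂ] A') (ψ : B →⋆ₙₐ[ℂ] B') (x y : SpatialTensor A B) :
    mapFun φ ψ (x + y) = mapFun φ ψ x + mapFun φ ψ y := by
  have hc := continuous_mapFun φ ψ
  induction x using induction_on with
  | hp => exact isClosed_eq (by fun_prop) (by fun_prop)
  | ih x =>
  induction y using induction_on with
  | hp => exact isClosed_eq (by fun_prop) (by fun_prop)
  | ih y => rw [← map_add, mapFun_ofAlg, mapFun_ofAlg, mapFun_ofAlg, map_add, map_add]

theorem mapFun_mul (φ : A →⋆ₙₐ[ℂ] A') (ψ : B →⋆ₙₐ[ℂ] B') (x y : SpatialTensor A B) :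
    mapFun φ ψ (x * y) = mapFun φ ψ x * mapFun φ ψ y := by
  have hc := continuous_mapFun φ ψ
  induction x using induction_on with
  | hp =>
    exact isClosed_eq (hc.comp (continuous_id.mul continuous_const))
      (hc.mul continuous_const)
  | ih x =>
  induction y using induction_on with
  | hp =>
    exact isClosed_eq (hc.comp (continuous_const.mul continuous_id))
      (continuous_const.mul hc)
  | ih y => rw [← ofAlg_mul, mapFun_ofAlg, mapFun_ofAlg, mapFun_ofAlg, map_mul, ofAlg_mul]

theorem mapFun_star (φ : A →⋆ₙₐ[ℂ] A') (ψ : B →⋆ₙₐ[ℂ] B') (x : SpatialTensor A B) :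
    mapFun φ ψ (star x) = star (mapFun φ ψ x) := by
  have hc := continuous_mapFun φ ψ
  induction x using induction_on with
  | hp => exact isClosed_eq (hc.comp continuous_star) hc.star
  | ih x => rw [← ofAlg_star, mapFun_ofAlg, mapFun_ofAlg, map_star, ofAlg_star]

/-- The `⋆`-homomorphism `φ ⊗ ψ` on spatial tensor products: the continuous extension of
`a ⊗ b ↦ φ(a) ⊗ ψ(b)`. -/
def map (φ : A →⋆ₙₐ[ℂ] A') (ψ : B →⋆ₙₐ[ℂ] B') :
    SpatialTensor A B →⋆ₙₐ[ℂ] SpatialTensor A' B' where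
  toFun := mapFun φ ψ
  map_smul' := mapFun_smul φ ψ
  map_zero' := by simpa using mapFun_smul φ ψ 0 0
  map_add' := mapFun_add φ ψ
  map_mul' := mapFun_mul φ ψ
  map_star' := mapFun_star φ ψ

theorem continuous_map (φ : A →⋆ₙₐ[ℂ] A') (ψ : B →⋆ₙₐ[ℂ] B') : Continuous (map φ ψ) :=
  continuous_mapFun φ ψ

theorem map_ofAlg (φ : A →⋆ₙₐ[ℂ] A') (ψ : B →⋆ₙₐ[ℂ] B') (x : AlgTensor A B) :
    map φ ψ (ofAlg x) = ofAlg (AlgTensor.map φ ψ x) :=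
  mapFun_ofAlg φ ψ x

theorem map_tmul (φ : A →⋆ₙₐ[ℂ] A') (ψ : B →⋆ₙₐ[ℂ] B') (a : A) (b : B) :
    map φ ψ (tmul a b) = tmul (φ a) (ψ b) :=
  map_ofAlg φ ψ _

theorem map_id : map (NonUnitalStarAlgHom.id ℂ A) (NonUnitalStarAlgHom.id ℂ B)
    = NonUnitalStarAlgHom.id ℂ (SpatialTensor A B) := by
  ext x
  induction x using induction_on with
  | hp => exact isClosed_eq (continuous_map _ _) continuous_id
  | ih x => rw [map_ofAlg, AlgTensor.map_id]; rfl

theorem map_comp_left (φ : A →⋆ₙₐ[ℂ] A') (φ' : A' →⋆ₙₐ[ℂ] A'') :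
    map (φ'.comp φ) (NonUnitalStarAlgHom.id ℂ B)
      = (map φ' (NonUnitalStarAlgHom.id ℂ B)).comp (map φ (NonUnitalStarAlgHom.id ℂ B)) := by
  ext x
  induction x using induction_on with
  | hp => exact isClosed_eq (continuous_map _ _) ((continuous_map _ _).comp (continuous_map _ _))
  | ih x => rw [NonUnitalStarAlgHom.comp_apply, map_ofAlg, map_ofAlg, map_ofAlg,
      AlgTensor.map_comp_left]

end SpatialTensor

/-! ### The category of C⋆-algebras -/

/-- The category of (not necessarily unital) C⋆-algebras and `⋆`-homomorphisms. -/
structure CStarAlgCat : Type (u + 1) where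
  /-- the underlying type -/
  carrier : Type u
  [str : NonUnitalCStarAlgebra carrier]

attribute [instance] CStarAlgCat.str

namespace CStarAlgCat

instance : CoeSort CStarAlgCat.{u} (Type u) := ⟨CStarAlgCat.carrier⟩

instance : Category CStarAlgCat.{u} where
  Hom A B := A →⋆ₙₐ[ℂ] B
  id A := NonUnitalStarAlgHom.id ℂ A
  comp f g := NonUnitalStarAlgHom.comp g f

/-- A C⋆-algebra as an object of the category. -/
abbrev of (A : Type u) [NonUnitalCStarAlgebra A] : CStarAlgCat.{u} := ⟨A⟩

/-- A `⋆`-homomorphism as a morphism of the category. -/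
abbrev ofHom {A B : Type u} [NonUnitalCStarAlgebra A] [NonUnitalCStarAlgebra B]
    (f : A →⋆ₙₐ[ℂ] B) : of A ⟶ of B := f

/-- The functor `A ↦ A ⊗ O`, with the spatial tensor product. -/
def tensorRight (O : Type u) [NonUnitalCStarAlgebra O] : CStarAlgCat.{u} ⥤ CStarAlgCat.{u} where
  obj A := of (SpatialTensor A O)
  map {A B} f := ofHom (SpatialTensor.map (A := A) (A' := B) f (NonUnitalStarAlgHom.id ℂ O))
  map_id _ := SpatialTensor.map_id
  map_comp f g := SpatialTensor.map_comp_left f g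

/-- The C⋆-algebra `M₂(A)`; its norm does not depend on the choice of the order on `A`, which is
the usual one. -/
def matrixTwo (A : Type u) [NonUnitalCStarAlgebra A] : CStarAlgCat.{u} :=
  letI : PartialOrder A := CStarAlgebra.spectralOrder A
  haveI : StarOrderedRing A := CStarAlgebra.spectralOrderedRing A
  of (CStarMatrix (Fin 2) (Fin 2) A)

end CStarAlgCat

/-- The upper left corner inclusion `a ↦ diag(a, 0)` as a `⋆`-homomorphism `A → M₂(A)`. -/
def cornerHom (A : Type u) [NonUnitalCStarAlgebra A] :
    A →⋆ₙₐ[ℂ] CStarMatrix (Fin 2) (Fin 2) A where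
  toFun a := CStarMatrix.ofMatrix !![a, 0; 0, 0]
  map_smul' c a := by ext i j; fin_cases i <;> fin_cases j <;> simp
  map_zero' := by ext i j; fin_cases i <;> fin_cases j <;> simp
  map_add' a b := by ext i j; fin_cases i <;> fin_cases j <;> simp
  map_mul' a b := by
    ext i j; fin_cases i <;> fin_cases j <;> simp [CStarMatrix.mul_apply]
  map_star' a := by
    ext i j; fin_cases i <;> fin_cases j <;> simp [CStarMatrix.star_apply]

namespace CStarAlgCat

/-- The upper left corner inclusion as a morphism `A ⟶ M₂(A)`. -/
def corner (A : CStarAlgCat.{u}) : A ⟶ matrixTwo A := cornerHom A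

end CStarAlgCat

/-! ### Properties of functors and algebras -/

/-- `E` is `M₂`-stable: it sends every corner inclusion `A ⟶ M₂(A)` to an isomorphism. -/
def IsM2Stable (E : CStarAlgCat.{u} ⥤ AddCommGrpCat.{v}) : Prop :=
  ∀ A : CStarAlgCat.{u}, IsIso (E.map (CStarAlgCat.corner A))

/-- `E` is split exact: it sends every extension `0 → J → A → B → 0` of C⋆-algebras that is split
by a `⋆`-homomorphism `s : B → A` to a short exact sequence of abelian groups (which `E(s)` then
splits). -/
def IsSplitExact (E : CStarAlgCat.{u} ⥤ AddCommGrpCat.{v}) : Prop :=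
  ∀ (J A B : Type u) [NonUnitalCStarAlgebra J] [NonUnitalCStarAlgebra A]
    [NonUnitalCStarAlgebra B] (i : J →⋆ₙₐ[ℂ] A) (p : A →⋆ₙₐ[ℂ] B) (s : B →⋆ₙₐ[ℂ] A),
    Function.Injective i → Function.Exact i p → p.comp s = NonUnitalStarAlgHom.id ℂ B →
      Function.Injective (E.map (CStarAlgCat.ofHom i)) ∧
      Function.Exact (E.map (CStarAlgCat.ofHom i)) (E.map (CStarAlgCat.ofHom p)) ∧
      Function.Surjective (E.map (CStarAlgCat.ofHom p))

/-- A homotopy of `⋆`-homomorphisms `A → B`: a family `Φ t`, `t ∈ [0, 1]`, of `⋆`-homomorphisms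
from `f` to `g` such that `t ↦ Φ t a` is norm continuous for every `a`; equivalently, a
`⋆`-homomorphism `A → C([0, 1], B)` whose evaluations at `0` and `1` are `f` and `g`. -/
def StarHomotopic {A B : Type u} [NonUnitalCStarAlgebra A] [NonUnitalCStarAlgebra B]
    (f g : A →⋆ₙₐ[ℂ] B) : Prop :=
  ∃ Φ : unitInterval → (A →⋆ₙₐ[ℂ] B),
    (∀ a, Continuous fun t => Φ t a) ∧ Φ 0 = f ∧ Φ 1 = g

/-- `F` is homotopy invariant: it sends homotopic `⋆`-homomorphisms to the same homomorphism. -/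
def IsHomotopyInvariant (F : CStarAlgCat.{u} ⥤ AddCommGrpCat.{v}) : Prop :=
  ∀ (A B : Type u) [NonUnitalCStarAlgebra A] [NonUnitalCStarAlgebra B] (f g : A →⋆ₙₐ[ℂ] B),
    StarHomotopic f g → F.map (CStarAlgCat.ofHom f) = F.map (CStarAlgCat.ofHom g)

/-- A unital C⋆-algebra is properly infinite if its unit is a properly infinite projection, that
is, if it contains two isometries with orthogonal ranges. -/
def IsProperlyInfinite (O : Type u) [CStarAlgebra O] : Prop :=
  ∃ s t : O, star s * s = 1 ∧ star t * t = 1 ∧ star s * t = 0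

end

open Filter Topology
open scoped BoundedContinuousFunction ZeroAtInfty

noncomputable section

/-! ### Isometric multipliers -/

/-! Put `X = A ⊗ O` and `Y = B ⊗ O`. The isometries of `O` give multipliers `V = 1 ⊗ s` and `W = 1 ⊗
t` of `Y` with orthogonal ranges. Hence homomorphisms into `Y` can be added inside `Y`: `f ⊕ g = V f
V⋆ + W g W⋆`. By `M₂`-stability `E` does not see conjugation by `V` or `W` (`IsM2Stable.map_ad`).

Given a homotopy `θ`, sum it over the dyadic points of level `n`: let `φ n`, `o n`, `ψ n` be the
iterated sums over `i < 2ⁿ` of `θ` at the left endpoints `i/2ⁿ`, the midpoints and the right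
endpoints `(i+1)/2ⁿ`. Refining the subdivision gives `φ (n+1) = φ n ⊕ o n` and `ψ (n+1) = o n ⊕ ψ
n`. Orthogonal sums have the norm of their largest term, so uniform continuity makes the three
sequences asymptotic despite the growing number of summands.

Asymptotic sequences are sections of one split extension of `X` by the null sequences `C₀(ℕ, Y)`, so
split exactness gives a difference class `y` of `φ` and `ψ` in `E(C₀(ℕ, Y))`, whose entry at `0` is
`E(θ 0) ξ - E(θ 1) ξ`. Insert `o` between them. Deleting the first entry turns `φ - ψ` into `(φ ⊕ o)
- (o ⊕ ψ)`, which telescopes through `o ⊕ o` to `V`- and `W`-conjugates of `φ - o` and `o - ψ`. Thus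
`y` is invariant under the left shift (`functorMap_eq_of_asymptotic`).

An Eilenberg swindle finishes. The homomorphism `S (aₙ) = ∑ Wⁿ V aₙ V⋆ W⋆ⁿ` satisfies `S a = V a₀ V⋆
+ W S(tail a) W⋆`, so for shift invariant `y` one gets `E(S) y = y₀ + E(S) y`, where `y₀` is the
entry of `y` at `0`. Hence `y₀ = 0`. -/

/-- An isometry in the multiplier algebra of `A`, given by its left multiplication operator
`a ↦ V a`; the right multiplication operator is `a ↦ a V⋆ = (V a⋆)⋆`. -/
structure IsometricMultiplier (A : Type u) [NonUnitalCStarAlgebra A] extends A →ₗ[ℂ] A where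
  map_mul_right' : ∀ a b, toFun (a * b) = toFun a * b
  star_mul_apply' : ∀ a b, star (toFun a) * toFun b = star a * b
  left_right_comm' : ∀ a, toFun (star (toFun (star a))) = star (toFun (star (toFun a)))

namespace IsometricMultiplier

variable {A : Type u} [NonUnitalCStarAlgebra A]

instance : CoeFun (IsometricMultiplier A) fun _ => A → A := ⟨fun V => V.toLinearMap⟩

variable (V : IsometricMultiplier A)

theorem map_mul_right (a b : A) : V (a * b) = V a * b := V.map_mul_right' a b

theorem star_mul_apply (a b : A) : star (V a) * V b = star a * b := V.star_mul_apply' a b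

/-- Since `a V⋆ = (V a⋆)⋆`, this is the associativity `V (a V⋆) = (V a) V⋆`. -/
theorem left_right_comm (a : A) : V (star (V (star a))) = star (V (star (V a))) :=
  V.left_right_comm' a

theorem apply_add (a b : A) : V (a + b) = V a + V b := V.map_add' a b

theorem apply_smul (c : ℂ) (a : A) : V (c • a) = c • V a := V.map_smul' c a

theorem apply_zero : V 0 = 0 := map_zero V.toLinearMap

theorem norm_apply (a : A) : ‖V a‖ = ‖a‖ := by
  have h : ‖V a‖ * ‖V a‖ = ‖a‖ * ‖a‖ := by
    rw [← CStarRing.norm_star_mul_self, star_mul_apply, CStarRing.norm_star_mul_self]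
  exact (mul_self_inj (norm_nonneg _) (norm_nonneg _)).1 h

/-- Conjugation by an isometric multiplier, `a ↦ V a V⋆`. -/
def ad : A →⋆ₙₐ[ℂ] A where
  toFun a := V (star (V (star a)))
  map_smul' c a := by
    simp only [star_smul, apply_smul, MonoidHom.id_apply, RCLike.star_def,
      Complex.conj_conj]
  map_zero' := by simp only [star_zero, apply_zero]
  map_add' a b := by simp only [star_add, apply_add]
  -- Both sides become `(V a)(b V⋆)`. On the right the first factor is reassociated as `(V a) V⋆`,
  -- so that its `V⋆` meets the `V` of the second factor.
  map_mul' a b := by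
    rw [star_mul, map_mul_right, star_mul, star_star, map_mul_right, V.left_right_comm a,
      star_mul_apply, star_star]
  map_star' a := by rw [star_star, V.left_right_comm, star_star]

theorem ad_apply (a : A) : V.ad a = V (star (V (star a))) := rfl

/-- Conjugation of `2 × 2` matrices by `diag(V, 1)`. -/
def adDiagOne : CStarMatrix (Fin 2) (Fin 2) A →⋆ₙₐ[ℂ] CStarMatrix (Fin 2) (Fin 2) A where
  toFun M := CStarMatrix.ofMatrix !![V.ad (M 0 0), V (M 0 1); star (V (star (M 1 0))), M 1 1]
  map_smul' c M := by
    ext i j; fin_cases i <;> fin_cases j <;> simp [map_smul, star_smul]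
  map_zero' := by ext i j; fin_cases i <;> fin_cases j <;> simp [apply_zero]
  map_add' M N := by
    ext i j; fin_cases i <;> fin_cases j <;> simp [map_add, star_add]
  map_mul' M N := by
    -- The image of a matrix with rows `(a, b)`, `(c, d)` has rows `(V a V⋆, V b)`, `(c V⋆, d)`. The
    -- identities `h₁` to `h₅` are the products of such entries, by associativity and `V⋆ V = 1`.
    have h₁ (b c : A) : V.ad (b * c) = V b * star (V (star c)) := by
      rw [ad_apply, star_mul, map_mul_right, star_mul, star_star, map_mul_right]
    have h₂ (a b : A) : V (a * b) = V.ad a * V b := by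
      rw [ad_apply, left_right_comm, star_mul_apply, star_star, map_mul_right]
    have h₃ (c a : A) : star (V (star (c * a))) = star (V (star c)) * V.ad a := by
      rw [ad_apply, star_mul_apply, star_star, star_mul, map_mul_right, star_mul, star_star]
    have h₄ (c d : A) : star (V (star (d * c))) = d * star (V (star c)) := by
      rw [star_mul, map_mul_right, star_mul, star_star]
    have h₅ (c b : A) : star (V (star c)) * V b = c * b := by rw [star_mul_apply, star_star]
    ext i j
    fin_cases i <;> fin_cases j
    · simp [CStarMatrix.mul_apply, ← h₁]
    · simp [CStarMatrix.mul_apply, ← h₂, ← map_mul_right]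
    · simp only [Fin.mk_one, Fin.zero_eta, CStarMatrix.mul_apply, Fin.sum_univ_two,
        CStarMatrix.ofMatrix_apply, Matrix.of_apply, Matrix.cons_val', Matrix.cons_val_zero,
        Matrix.cons_val_one, Matrix.cons_val_fin_one, star_add, apply_add, ← h₃, ← h₄]
    · simp [CStarMatrix.mul_apply, h₅]
  map_star' M := by
    ext i j; fin_cases i <;> fin_cases j <;> simp [CStarMatrix.star_apply, map_star]

end IsometricMultiplier

/-- Exchanging the two coordinates of `2 × 2` matrices. -/
def matrixSwap (A : Type u) [NonUnitalCStarAlgebra A] :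
    CStarMatrix (Fin 2) (Fin 2) A →⋆ₙₐ[ℂ] CStarMatrix (Fin 2) (Fin 2) A where
  toFun M := CStarMatrix.ofMatrix !![M 1 1, M 1 0; M 0 1, M 0 0]
  map_smul' c M := by ext i j; fin_cases i <;> fin_cases j <;> simp
  map_zero' := by ext i j; fin_cases i <;> fin_cases j <;> simp
  map_add' M N := by ext i j; fin_cases i <;> fin_cases j <;> simp
  map_mul' M N := by
    ext i j; fin_cases i <;> fin_cases j <;> simp [CStarMatrix.mul_apply, add_comm]
  map_star' M := by
    ext i j; fin_cases i <;> fin_cases j <;> simp [CStarMatrix.star_apply]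

theorem matrixSwap_comp_self (A : Type u) [NonUnitalCStarAlgebra A] :
    (matrixSwap A).comp (matrixSwap A) = NonUnitalStarAlgHom.id ℂ _ := by
  ext M i j; fin_cases i <;> fin_cases j <;> simp [matrixSwap]

namespace IsometricMultiplier

variable {A : Type u} [NonUnitalCStarAlgebra A] (V : IsometricMultiplier A)

/-- Conjugation by `diag(V, 1)` sees `V` only in the upper left corner. Together with its triviality
on the lower right corner this lets the matrix algebra compare `V.ad` with the identity. -/
theorem adDiagOne_comp_cornerHom : V.adDiagOne.comp (cornerHom A) = (cornerHom A).comp V.ad := by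
  ext a i j; fin_cases i <;> fin_cases j <;> simp [adDiagOne, cornerHom]

theorem adDiagOne_comp_matrixSwap_comp_cornerHom :
    V.adDiagOne.comp ((matrixSwap A).comp (cornerHom A)) = (matrixSwap A).comp (cornerHom A) := by
  ext a i j; fin_cases i <;> fin_cases j <;> simp [adDiagOne, matrixSwap, cornerHom]

end IsometricMultiplier

/-! ### Functors on the category of C⋆-algebras -/

section Functor

variable (E : CStarAlgCat.{u} ⥤ AddCommGrpCat.{v})

/-- The group homomorphism `E(f)`. -/
def functorMap {A B : Type u} [NonUnitalCStarAlgebra A] [NonUnitalCStarAlgebra B]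
    (f : A →⋆ₙₐ[ℂ] B) : E.obj (.of A) →+ E.obj (.of B) :=
  (E.map (CStarAlgCat.ofHom f)).hom

variable {E} {A B C : Type u} [NonUnitalCStarAlgebra A] [NonUnitalCStarAlgebra B]
  [NonUnitalCStarAlgebra C]

theorem functorMap_id (x : E.obj (.of A)) :
    functorMap E (NonUnitalStarAlgHom.id ℂ A) x = x :=
  congrArg (fun f : E.obj (.of A) ⟶ E.obj (.of A) => f.hom x) (E.map_id (.of A))

theorem functorMap_comp (g : B →⋆ₙₐ[ℂ] C) (f : A →⋆ₙₐ[ℂ] B) (x : E.obj (.of A)) :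
    functorMap E g (functorMap E f x) = functorMap E (g.comp f) x :=
  (congrArg (fun f : E.obj (.of A) ⟶ E.obj (.of C) => f.hom x)
    (E.map_comp (CStarAlgCat.ofHom f) (CStarAlgCat.ofHom g))).symm

/-- An `M₂`-stable functor sends the corner inclusion to a bijection. -/
theorem IsM2Stable.bijective_corner (hM : IsM2Stable E) (A : Type u) [NonUnitalCStarAlgebra A] :
    letI : PartialOrder A := CStarAlgebra.spectralOrder A
    haveI : StarOrderedRing A := CStarAlgebra.spectralOrderedRing A
    Function.Bijective (functorMap E (cornerHom A)) := by
  have := hM (.of A)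
  exact ConcreteCategory.bijective_of_isIso (E.map (CStarAlgCat.corner (.of A)))

/-- Inner endomorphisms act trivially on `M₂`-stable functors. -/
theorem IsM2Stable.map_ad (hM : IsM2Stable E) (V : IsometricMultiplier A) (x : E.obj (.of A)) :
    functorMap E V.ad x = x := by
  -- The order fixed in `matrixTwo`, so that the matrix algebra is the object in the stability
  -- hypothesis.
  let : PartialOrder A := CStarAlgebra.spectralOrder A
  have : StarOrderedRing A := CStarAlgebra.spectralOrderedRing A
  have hc := hM.bijective_corner A
  -- The lower right corner inclusion is the swap after the upper left one, hence also surjective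
  -- under `E`; conjugation by `diag(V, 1)` fixes it, so it acts as the identity on all of
  -- `E(M₂(A))`.
  have had (y : E.obj (.of (CStarMatrix (Fin 2) (Fin 2) A))) : functorMap E V.adDiagOne y = y := by
    obtain ⟨z, hz⟩ := hc.2 (functorMap E (matrixSwap A) y)
    have hy : functorMap E ((matrixSwap A).comp (cornerHom A)) z = y := by
      rw [← functorMap_comp, hz, functorMap_comp, matrixSwap_comp_self, functorMap_id]
    rw [← hy, functorMap_comp, V.adDiagOne_comp_matrixSwap_comp_cornerHom]
  apply hc.1
  rw [functorMap_comp, ← V.adDiagOne_comp_cornerHom, ← functorMap_comp, had]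

variable {J : Type u} [NonUnitalCStarAlgebra J]

/-- The zero homomorphism is the composite of the two maps in the split extension `A → A × B → B`,
so exactness in the middle kills it. Additivity of `E` on morphisms is not available. -/
theorem IsSplitExact.map_zero (hE : IsSplitExact E) (x : E.obj (.of A)) :
    functorMap E (0 : A →⋆ₙₐ[ℂ] B) x = 0 := by
  have h := (hE A (A × B) B (NonUnitalStarAlgHom.inl ℂ A B) (NonUnitalStarAlgHom.snd ℂ A B)
    (NonUnitalStarAlgHom.inr ℂ A B) (fun a a' h => congrArg Prod.fst h)
    (fun p => ⟨fun h => ⟨p.1, Prod.ext rfl h.symm⟩, by rintro ⟨a, rfl⟩; rfl⟩) rfl).2.1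
  have h' := (h (functorMap E (NonUnitalStarAlgHom.inl ℂ A B) x)).2 ⟨x, rfl⟩
  exact (functorMap_comp _ _ x).symm.trans h'

end Functor

end

noncomputable section

/-! ### Isometries acting on the second tensor factor -/

namespace AlgTensor

variable {A O : Type u} [NonUnitalCStarAlgebra A] [CStarAlgebra O]

/-- Left multiplication by `1 ⊗ s` on `A ⊙ O`. -/
def mulLeftRight (s : O) : AlgTensor A O →ₗ[ℂ] AlgTensor A O :=
  (TensorProduct.map LinearMap.id (LinearMap.mulLeft ℂ s) : A ⊗[ℂ] O →ₗ[ℂ] A ⊗[ℂ] O)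

theorem mulLeftRight_tmul (s : O) (a : A) (o : O) :
    mulLeftRight s (tmul a o) = tmul a (s * o) := rfl

@[elab_as_elim]
theorem induction_tmul {p : AlgTensor A O → Prop} (x : AlgTensor A O) (zero : p 0)
    (tmul : ∀ a o, p (tmul a o)) (add : ∀ x y, p x → p y → p (x + y)) : p x :=
  TensorProduct.induction_on x zero tmul add

theorem tmul_mul_tmul (a a' : A) (o o' : O) :
    tmul a o * tmul a' o' = tmul (a * a') (o * o') :=
  Algebra.TensorProduct.tmul_mul_tmul a a' o o'

theorem star_tmul (a : A) (o : O) : star (tmul a o) = tmul (star a) (star o) :=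
  TensorProduct.star_tmul a o

theorem tmul_zero (a : A) : tmul a (0 : O) = 0 := TensorProduct.tmul_zero O a

theorem mulLeftRight_mul (s : O) (x y : AlgTensor A O) :
    mulLeftRight s (x * y) = mulLeftRight s x * y := by
  induction x using induction_tmul with
  | zero => simp
  | add x x' hx hx' => simp only [add_mul, map_add, hx, hx']
  | tmul a o =>
    induction y using induction_tmul with
    | zero => simp
    | add y y' hy hy' => simp only [mul_add, map_add, hy, hy']
    | tmul a' o' => simp only [tmul_mul_tmul, mulLeftRight_tmul, mul_assoc]

theorem star_mulLeftRight_mul (s t : O) (x y : AlgTensor A O) :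
    star (mulLeftRight s x) * mulLeftRight t y = star x * mulLeftRight (star s * t) y := by
  induction x using induction_tmul with
  | zero => simp
  | add x x' hx hx' => simp only [add_mul, map_add, star_add, hx, hx']
  | tmul a o =>
    induction y using induction_tmul with
    | zero => simp
    | add y y' hy hy' => simp only [mul_add, map_add, hy, hy']
    | tmul a' o' => simp only [tmul_mul_tmul, mulLeftRight_tmul, star_tmul, star_mul, mul_assoc]

theorem mulLeftRight_one (x : AlgTensor A O) : mulLeftRight 1 x = x := by
  induction x using induction_tmul with
  | zero => simp
  | add x x' hx hx' => simp only [map_add, hx, hx']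
  | tmul a o => rw [mulLeftRight_tmul, one_mul]

theorem mulLeftRight_zero (x : AlgTensor A O) : mulLeftRight 0 x = 0 := by
  induction x using induction_tmul with
  | zero => simp
  | add x x' hx hx' => rw [map_add, hx, hx', add_zero]
  | tmul a o => rw [mulLeftRight_tmul, zero_mul, tmul_zero]

theorem mulLeftRight_comm (s : O) (x : AlgTensor A O) :
    mulLeftRight s (star (mulLeftRight s (star x)))
      = star (mulLeftRight s (star (mulLeftRight s x))) := by
  induction x using induction_tmul with
  | zero => simp
  | add x x' hx hx' => simp only [map_add, star_add, hx, hx']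
  | tmul a o => simp only [star_tmul, mulLeftRight_tmul, star_mul, star_star, mul_assoc]

/-- The C⋆-inequality reduces the bound to `(s x)⋆ (s x) = x⋆ x`. This is what allows `1 ⊗ s` to be
extended to the completion. -/
theorem norm_mulLeftRight_le {s : O} (hs : star s * s = 1) (x : AlgTensor A O) :
    ‖mulLeftRight s x‖ ≤ ‖x‖ := by
  refine abs_le_of_sq_le_sq' ?_ (norm_nonneg x) |>.2
  rw [pow_two, pow_two]
  calc _ ≤ ‖star (mulLeftRight s x) * mulLeftRight s x‖ := norm_mul_self_le _
    _ = ‖star x * x‖ := by rw [star_mulLeftRight_mul, hs, mulLeftRight_one]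
    _ ≤ ‖x‖ * ‖x‖ := (norm_mul_le _ _).trans_eq (by rw [norm_star])

end AlgTensor

namespace SpatialTensor

variable {A O : Type u} [NonUnitalCStarAlgebra A] [CStarAlgebra O]

/-- Left multiplication by `1 ⊗ s` on `A ⊗ O`, for an isometry `s`. -/
def mulLeftRight (s : O) (hs : star s * s = 1) : SpatialTensor A O →L[ℂ] SpatialTensor A O :=
  ((AlgTensor.mulLeftRight s).mkContinuous 1 fun x => by
    simpa using AlgTensor.norm_mulLeftRight_le hs x).completion

theorem mulLeftRight_ofAlg {s : O} (hs : star s * s = 1) (x : AlgTensor A O) :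
    mulLeftRight s hs (ofAlg x) = ofAlg (AlgTensor.mulLeftRight s x) :=
  ContinuousLinearMap.completion_apply_coe _ x

/-- The isometric multiplier `1 ⊗ s` of `A ⊗ O`. -/
def isometricMultiplier (A : Type u) [NonUnitalCStarAlgebra A] (s : O) (hs : star s * s = 1) :
    IsometricMultiplier (SpatialTensor A O) where
  __ := (mulLeftRight s hs).toLinearMap
  map_mul_right' x y := by
    change mulLeftRight s hs (x * y) = mulLeftRight s hs x * y
    induction x using induction_on with
    | hp => exact isClosed_eq (by fun_prop) (by fun_prop)
    | ih x =>
    induction y using induction_on with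
    | hp => exact isClosed_eq (by fun_prop) (by fun_prop)
    | ih y => simp only [← ofAlg_mul, mulLeftRight_ofAlg, AlgTensor.mulLeftRight_mul]
  star_mul_apply' x y := by
    change star (mulLeftRight s hs x) * mulLeftRight s hs y = star x * y
    induction x using induction_on with
    | hp => exact isClosed_eq (by fun_prop) (by fun_prop)
    | ih x =>
    induction y using induction_on with
    | hp => exact isClosed_eq (by fun_prop) (by fun_prop)
    | ih y =>
      simp only [← ofAlg_mul, ← ofAlg_star, mulLeftRight_ofAlg, AlgTensor.star_mulLeftRight_mul,
        hs, AlgTensor.mulLeftRight_one]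
  left_right_comm' x := by
    change mulLeftRight s hs (star (mulLeftRight s hs (star x)))
      = star (mulLeftRight s hs (star (mulLeftRight s hs x)))
    induction x using induction_on with
    | hp => exact isClosed_eq (by fun_prop) (by fun_prop)
    | ih x => simp only [← ofAlg_star, mulLeftRight_ofAlg, AlgTensor.mulLeftRight_comm]

theorem star_isometricMultiplier_mul {s t : O} (hs : star s * s = 1) (ht : star t * t = 1)
    (hst : star s * t = 0) (x y : SpatialTensor A O) :
    star (isometricMultiplier A s hs x) * isometricMultiplier A t ht y = 0 := by
  change star (mulLeftRight s hs x) * mulLeftRight t ht y = 0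
  induction x using induction_on with
  | hp => exact isClosed_eq (by fun_prop) (by fun_prop)
  | ih x =>
  induction y using induction_on with
  | hp => exact isClosed_eq (by fun_prop) (by fun_prop)
  | ih y =>
    rw [mulLeftRight_ofAlg, mulLeftRight_ofAlg, ← ofAlg_star, ← ofAlg_mul,
      AlgTensor.star_mulLeftRight_mul, hst, AlgTensor.mulLeftRight_zero, mul_zero, map_zero]

/-- A pointwise continuous family of `⋆`-homomorphisms stays so after tensoring with `O`. -/
theorem continuous_map_apply {T : Type*} [TopologicalSpace T] {B : Type u}
    [NonUnitalCStarAlgebra B] {Φ : T → (A →⋆ₙₐ[ℂ] B)} (hΦ : ∀ a, Continuous fun t => Φ t a)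
    (x : SpatialTensor A O) :
    Continuous fun t => map (Φ t) (NonUnitalStarAlgHom.id ℂ O) x := by
  have halg (x : AlgTensor A O) :
      Continuous fun t => map (Φ t) (NonUnitalStarAlgHom.id ℂ O) (ofAlg x) := by
    induction x using AlgTensor.induction_tmul with
    | zero => simpa only [map_zero] using continuous_const
    | add x y hx hy =>
      simp only [map_add]
      exact hx.add hy
    | tmul a o =>
      -- The cross-norm estimate `‖b ⊗ o‖ ≤ ‖b‖ ‖o‖`, which holds in every product representation.
      have hL : Continuous fun b : B => (tmul b o : SpatialTensor B O) := by
        let L : B →ₗ[ℂ] SpatialTensor B O := ofAlg.toLinearMap ∘ₗ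
          (((TensorProduct.mk ℂ B O).flip o : B →ₗ[ℂ] B ⊗[ℂ] O) : B →ₗ[ℂ] AlgTensor B O)
        refine (L.mkContinuous ‖o‖ fun b => ?_).continuous
        refine (norm_ofAlg (AlgTensor.tmul b o)).trans_le ?_
        refine AlgTensor.spatialNorm_le (by positivity) fun p => ?_
        refine (HilbertTensor.norm_map_le (p.1.π b) (p.2.π o)).trans ?_
        rw [mul_comm]
        gcongr
        · exact NonUnitalStarAlgHom.norm_apply_le p.2.π o
        · exact NonUnitalStarAlgHom.norm_apply_le p.1.π b
      exact (hL.comp (hΦ a)).congr fun t =>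
        (map_tmul (Φ t) (NonUnitalStarAlgHom.id ℂ O) a o).symm
  -- All the homomorphisms are contractive, so approximating `x` by an algebraic tensor approximates
  -- its image uniformly in `t`.
  refine continuous_of_uniform_approx_of_continuous fun U hU => ?_
  obtain ⟨ε, hε, hU⟩ := Metric.mem_uniformity_dist.1 hU
  obtain ⟨y, hy⟩ := denseRange_ofAlg.exists_dist_lt x hε
  refine ⟨_, halg y, fun t => hU ?_⟩
  rw [dist_eq_norm, ← map_sub]
  exact (NonUnitalStarAlgHom.norm_apply_le _ _).trans_lt (by rwa [← dist_eq_norm])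

end SpatialTensor

end

noncomputable section

/-! ### Orthogonal pairs of isometric multipliers -/

namespace IsometricMultiplier

variable {X Y : Type u} [NonUnitalCStarAlgebra X] [NonUnitalCStarAlgebra Y]

/-- Two isometric multipliers `V`, `W` have orthogonal ranges if `V⋆ W = 0`. -/
def Orthogonal (V W : IsometricMultiplier Y) : Prop := ∀ a b, star (V a) * W b = 0

variable {V W : IsometricMultiplier Y}

theorem Orthogonal.ad_mul_ad (h : V.Orthogonal W) (a b : Y) : V.ad a * W.ad b = 0 := by
  rw [ad_apply V, left_right_comm]
  exact h _ _

theorem Orthogonal.symm (h : V.Orthogonal W) : W.Orthogonal V := fun a b => by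
  rw [← star_eq_zero, star_mul, star_star]
  exact h b a

/-- The `⋆`-homomorphism `(a, b) ↦ V a V⋆ + W b W⋆`. -/
def Orthogonal.adSum (h : V.Orthogonal W) : Y × Y →⋆ₙₐ[ℂ] Y where
  toFun p := V.ad p.1 + W.ad p.2
  map_smul' c p := by simp
  map_zero' := by simp
  map_add' p q := by simp only [Prod.fst_add, Prod.snd_add, map_add]; abel
  map_mul' p q := by
    simp only [Prod.fst_mul, Prod.snd_mul, map_mul, add_mul, mul_add, h.ad_mul_ad,
      h.symm.ad_mul_ad, add_zero, zero_add]
  map_star' p := by simp [map_star]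

theorem Orthogonal.adSum_apply (h : V.Orthogonal W) (p : Y × Y) :
    h.adSum p = V.ad p.1 + W.ad p.2 := rfl

/-- The orthogonal sum of the `⋆`-homomorphisms `f 0, …, f (2 ^ n - 1)`, conjugated by the words of
length `n` in `V` and `W`. -/
def Orthogonal.dyadicSum (h : V.Orthogonal W) : ℕ → (ℕ → X →⋆ₙₐ[ℂ] Y) → X →⋆ₙₐ[ℂ] Y
  | 0, f => f 0
  | n + 1, f => h.adSum.comp
      ((h.dyadicSum n fun i => f (2 * i)).prod (h.dyadicSum n fun i => f (2 * i + 1)))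

/-- `adSum` is a `⋆`-homomorphism on `Y × Y` with the sup norm, hence contractive. The error is
therefore the maximum of the errors of the summands, with no factor `2 ^ n`. -/
theorem Orthogonal.norm_dyadicSum_sub_le (h : V.Orthogonal W) (n : ℕ) {f g : ℕ → X →⋆ₙₐ[ℂ] Y}
    {x : X} {ε : ℝ} (hfg : ∀ i, ‖f i x - g i x‖ ≤ ε) :
    ‖h.dyadicSum n f x - h.dyadicSum n g x‖ ≤ ε := by
  induction n generalizing f g with
  | zero => exact hfg 0
  | succ n ih =>
    rw [dyadicSum, dyadicSum, NonUnitalStarAlgHom.comp_apply, NonUnitalStarAlgHom.comp_apply,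
      ← map_sub]
    exact (NonUnitalStarAlgHom.norm_apply_le _ _).trans
      (max_le (ih fun i => hfg _) (ih fun i => hfg _))

/-- One modulus of continuity of `r ↦ θ r x` serves all `2 ^ n` pairs of sample points at once. -/
theorem Orthogonal.tendsto_dyadicSum_sub (h : V.Orthogonal W) {θ : ℝ → X →⋆ₙₐ[ℂ] Y}
    (hθ : ∀ x, UniformContinuous fun r => θ r x) {p q : ℕ → ℕ → ℝ}
    (hpq : ∀ n i, |p n i - q n i| ≤ (1 / 2) ^ n) (x : X) :
    Tendsto (fun n => h.dyadicSum n (fun i => θ (p n i)) x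
      - h.dyadicSum n (fun i => θ (q n i)) x) atTop (𝓝 0) := by
  rw [NormedAddGroup.tendsto_nhds_zero]
  intro ε hε
  obtain ⟨δ, hδ, H⟩ := Metric.uniformContinuous_iff.1 (hθ x) (ε / 2) (half_pos hε)
  have hlim : Tendsto (fun n : ℕ => (1 / 2 : ℝ) ^ n) atTop (𝓝 0) :=
    tendsto_pow_atTop_nhds_zero_of_lt_one (by norm_num) (by norm_num)
  filter_upwards [hlim.eventually (gt_mem_nhds hδ)] with n hn
  refine (h.norm_dyadicSum_sub_le n fun i => ?_).trans_lt (half_lt_self hε)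
  rw [← dist_eq_norm]
  exact (H ((hpq n i).trans_lt hn)).le

end IsometricMultiplier

/-! ### Null sequences -/

section NullSequences

variable {X Y Z : Type u} [NonUnitalCStarAlgebra X] [NonUnitalCStarAlgebra Y]
  [NonUnitalCStarAlgebra Z]

theorem tendsto_zeroAtInfty_nat (a : C₀(ℕ, Y)) : Tendsto a atTop (𝓝 0) := by
  simpa only [cocompact_eq_cofinite, Nat.cofinite_eq_atTop] using zero_at_infty a

/-- Evaluation of null sequences. -/
def nullEval (Y : Type u) [NonUnitalCStarAlgebra Y] (n : ℕ) : C₀(ℕ, Y) →⋆ₙₐ[ℂ] Y where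
  toFun a := a n
  map_smul' _ _ := rfl
  map_zero' := rfl
  map_add' _ _ := rfl
  map_mul' _ _ := rfl
  map_star' _ := rfl

theorem nullEval_apply (n : ℕ) (a : C₀(ℕ, Y)) : nullEval Y n a = a n := rfl

/-- The `⋆`-homomorphism into null sequences with prescribed coordinates. -/
def nullLift (f : ℕ → Z →⋆ₙₐ[ℂ] Y) (hf : ∀ z, Tendsto (fun n => f n z) atTop (𝓝 0)) :
    Z →⋆ₙₐ[ℂ] C₀(ℕ, Y) where
  toFun z :=
    { toFun := fun n => f n z
      continuous_toFun := continuous_of_discreteTopology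
      zero_at_infty' := by simpa only [cocompact_eq_cofinite, Nat.cofinite_eq_atTop] using hf z }
  map_smul' c z := ZeroAtInftyContinuousMap.ext fun n => map_smul (f n) c z
  map_zero' := ZeroAtInftyContinuousMap.ext fun n => map_zero (f n)
  map_add' x y := ZeroAtInftyContinuousMap.ext fun n => map_add (f n) x y
  map_mul' x y := ZeroAtInftyContinuousMap.ext fun n => map_mul (f n) x y
  map_star' z := ZeroAtInftyContinuousMap.ext fun n => map_star (f n) z

/-- The left shift `(a₀, a₁, …) ↦ (a₁, a₂, …)`. -/
def nullTail (Y : Type u) [NonUnitalCStarAlgebra Y] : C₀(ℕ, Y) →⋆ₙₐ[ℂ] C₀(ℕ, Y) :=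
  nullLift (fun n => nullEval Y (n + 1))
    fun a => (tendsto_zeroAtInfty_nat a).comp (tendsto_add_atTop_nat 1)

/-- The right shift `(a₀, a₁, …) ↦ (0, a₀, a₁, …)`. -/
def nullShift (Y : Type u) [NonUnitalCStarAlgebra Y] : C₀(ℕ, Y) →⋆ₙₐ[ℂ] C₀(ℕ, Y) :=
  nullLift (fun n => Nat.casesOn n 0 (nullEval Y))
    fun a => (tendsto_add_atTop_iff_nat 1).1 (tendsto_zeroAtInfty_nat a)

/-- The inclusion `y ↦ (y, 0, 0, …)`. -/
def nullSingle (Y : Type u) [NonUnitalCStarAlgebra Y] : Y →⋆ₙₐ[ℂ] C₀(ℕ, Y) :=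
  nullLift (fun n => Nat.casesOn n (NonUnitalStarAlgHom.id ℂ Y) fun _ => 0)
    fun _ => (tendsto_add_atTop_iff_nat 1).1 tendsto_const_nhds

theorem nullTail_comp_nullShift :
    (nullTail Y).comp (nullShift Y) = NonUnitalStarAlgHom.id ℂ C₀(ℕ, Y) := rfl

theorem nullTail_comp_nullSingle : (nullTail Y).comp (nullSingle Y) = 0 := rfl

theorem nullEval_comp_nullSingle :
    (nullEval Y 0).comp (nullSingle Y) = NonUnitalStarAlgHom.id ℂ Y := rfl

theorem nullShift_injective : Function.Injective (nullShift Y) :=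
  Function.LeftInverse.injective (g := nullTail Y) fun _ => rfl

theorem exact_nullShift_nullEval : Function.Exact (nullShift Y) (nullEval Y 0) := fun a =>
  ⟨fun h => ⟨nullTail Y a, by
    ext n
    cases n with
    | zero => exact h.symm
    | succ n => rfl⟩, by rintro ⟨b, rfl⟩; rfl⟩

/-- A split exact functor decomposes null sequences into first entry and tail. -/
theorem IsSplitExact.eq_single_add_shift {E : CStarAlgCat.{u} ⥤ AddCommGrpCat.{v}}
    (hE : IsSplitExact E) (y : E.obj (.of C₀(ℕ, Y))) :
    y = functorMap E (nullSingle Y) (functorMap E (nullEval Y 0) y)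
      + functorMap E (nullShift Y) (functorMap E (nullTail Y) y) := by
  -- Removing the first entry leaves a class killed by evaluation at `0`, which by exactness comes
  -- from the right shift.
  set z := y - functorMap E (nullSingle Y) (functorMap E (nullEval Y 0) y) with hz
  have h₀ : functorMap E (nullEval Y 0) z = 0 := by
    rw [hz, map_sub, functorMap_comp (nullEval Y 0) (nullSingle Y), nullEval_comp_nullSingle,
      functorMap_id, sub_self]
  obtain ⟨w, hw⟩ : ∃ w, functorMap E (nullShift Y) w = z :=
    ((hE _ _ _ (nullShift Y) (nullEval Y 0) (nullSingle Y) nullShift_injective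
      exact_nullShift_nullEval nullEval_comp_nullSingle).2.1 z).1 h₀
  -- The tail map is a left inverse of the shift and annihilates sequences concentrated at `0`, so
  -- it recovers `w` from `y`.
  have h₁ : w = functorMap E (nullTail Y) y := by
    rw [← functorMap_id w, ← nullTail_comp_nullShift, ← functorMap_comp, hw, hz, map_sub,
      functorMap_comp (nullTail Y) (nullSingle Y), nullTail_comp_nullSingle, hE.map_zero, sub_zero]
  rw [← h₁, hw, hz, add_sub_cancel]

/-! ### Infinite orthogonal sums of null sequences -/

namespace IsometricMultiplier

/-- An isometric multiplier acting entrywise on null sequences. -/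
def null (V : IsometricMultiplier Y) : IsometricMultiplier C₀(ℕ, Y) where
  toFun a :=
    { toFun := fun n => V (a n)
      continuous_toFun := continuous_of_discreteTopology
      zero_at_infty' := by
        rw [tendsto_zero_iff_norm_tendsto_zero]
        simpa only [V.norm_apply] using tendsto_zero_iff_norm_tendsto_zero.1 (zero_at_infty a) }
  map_add' a b := ZeroAtInftyContinuousMap.ext fun n => V.apply_add (a n) (b n)
  map_smul' c a := ZeroAtInftyContinuousMap.ext fun n => V.apply_smul c (a n)
  map_mul_right' a b := ZeroAtInftyContinuousMap.ext fun n => V.map_mul_right (a n) (b n)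
  star_mul_apply' a b := ZeroAtInftyContinuousMap.ext fun n => V.star_mul_apply (a n) (b n)
  left_right_comm' a := ZeroAtInftyContinuousMap.ext fun n => V.left_right_comm (a n)

variable {V W : IsometricMultiplier Y}

/-- The partial sums `∑ n < N, Wⁿ V aₙ V⋆ W⋆ⁿ`. -/
def Orthogonal.partialSum (h : V.Orthogonal W) : ℕ → C₀(ℕ, Y) →⋆ₙₐ[ℂ] Y
  | 0 => 0
  | N + 1 => h.adSum.comp ((nullEval Y 0).prod ((h.partialSum N).comp (nullTail Y)))

theorem Orthogonal.partialSum_succ (h : V.Orthogonal W) (N : ℕ) (a : C₀(ℕ, Y)) :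
    h.partialSum (N + 1) a = h.adSum (a 0, h.partialSum N (nullTail Y a)) := rfl

/-- The terms of the sum are mutually orthogonal, so a block of it is as small as its largest entry.
A null sequence therefore has Cauchy partial sums, with no summability needed. -/
theorem Orthogonal.norm_partialSum_sub_le (h : V.Orthogonal W) {N : ℕ} {a : C₀(ℕ, Y)} {ε : ℝ}
    (hε : 0 ≤ ε) (ha : ∀ m, N ≤ m → ‖a m‖ ≤ ε) (k : ℕ) :
    ‖h.partialSum (N + k) a - h.partialSum N a‖ ≤ ε := by
  induction N generalizing a with
  | zero =>
    have : ‖a‖ ≤ ε := by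
      rw [← ZeroAtInftyContinuousMap.norm_toBCF_eq_norm]
      exact (BoundedContinuousFunction.norm_le hε).2 fun m => ha m m.zero_le
    simpa [partialSum] using (NonUnitalStarAlgHom.norm_apply_le (h.partialSum k) a).trans this
  | succ N ih =>
    rw [Nat.add_right_comm, partialSum_succ, partialSum_succ, ← map_sub]
    refine (NonUnitalStarAlgHom.norm_apply_le _ _).trans (max_le ?_ ?_)
    · simpa using hε
    · exact ih fun m hm => ha (m + 1) (Nat.succ_le_succ hm)

theorem Orthogonal.exists_tendsto_partialSum (h : V.Orthogonal W) (a : C₀(ℕ, Y)) :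
    ∃ y, Tendsto (fun N => h.partialSum N a) atTop (𝓝 y) := by
  refine cauchySeq_tendsto_of_complete (Metric.cauchySeq_iff'.2 fun ε hε => ?_)
  have hlim := NormedAddGroup.tendsto_nhds_zero.1 (tendsto_zeroAtInfty_nat a) (ε / 2) (half_pos hε)
  obtain ⟨N, hN⟩ := eventually_atTop.1 hlim
  refine ⟨N, fun n hn => ?_⟩
  obtain ⟨k, rfl⟩ := Nat.exists_eq_add_of_le hn
  rw [dist_eq_norm]
  exact (h.norm_partialSum_sub_le (half_pos hε).le (fun m hm => (hN m hm).le) k).trans_lt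
    (half_lt_self hε)

/-- The `⋆`-homomorphism `(aₙ) ↦ ∑ n, Wⁿ V aₙ V⋆ W⋆ⁿ`. -/
def Orthogonal.infiniteSum (h : V.Orthogonal W) : C₀(ℕ, Y) →⋆ₙₐ[ℂ] Y :=
  have H := fun a => (h.exists_tendsto_partialSum a).choose_spec
  { toFun := fun a => (h.exists_tendsto_partialSum a).choose
    map_smul' := fun c a => tendsto_nhds_unique (H (c • a)) <|
      ((H a).const_smul c).congr fun N => (map_smul (h.partialSum N) c a).symm
    map_zero' := tendsto_nhds_unique (H 0) <|
      tendsto_const_nhds.congr fun N => (map_zero (h.partialSum N)).symm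
    map_add' := fun a b => tendsto_nhds_unique (H (a + b)) <|
      ((H a).add (H b)).congr fun N => (map_add (h.partialSum N) a b).symm
    map_mul' := fun a b => tendsto_nhds_unique (H (a * b)) <|
      ((H a).mul (H b)).congr fun N => (map_mul (h.partialSum N) a b).symm
    map_star' := fun a => tendsto_nhds_unique (H (star a)) <|
      (H a).star.congr fun N => (map_star (h.partialSum N) a).symm }

theorem Orthogonal.tendsto_partialSum (h : V.Orthogonal W) (a : C₀(ℕ, Y)) :
    Tendsto (fun N => h.partialSum N a) atTop (𝓝 (h.infiniteSum a)) :=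
  (h.exists_tendsto_partialSum a).choose_spec

/-- The limit of the recursion for the partial sums. This self-similarity is what drives the
swindle. -/
theorem Orthogonal.infiniteSum_eq (h : V.Orthogonal W) (a : C₀(ℕ, Y)) :
    h.infiniteSum a = V.ad (a 0) + W.ad (h.infiniteSum (nullTail Y a)) := by
  have hc : Continuous W.ad := AddMonoidHomClass.continuous_of_bound W.ad 1 fun y => by
    simpa using NonUnitalStarAlgHom.norm_apply_le W.ad y
  refine tendsto_nhds_unique ((tendsto_add_atTop_iff_nat 1).2 (h.tendsto_partialSum a)) ?_
  exact ((hc.tendsto _).comp (h.tendsto_partialSum (nullTail Y a))).const_add (V.ad (a 0))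

theorem Orthogonal.infiniteSum_comp_nullSingle (h : V.Orthogonal W) :
    h.infiniteSum.comp (nullSingle Y) = V.ad := by
  ext y
  rw [NonUnitalStarAlgHom.comp_apply, h.infiniteSum_eq]
  have : nullTail Y (nullSingle Y y) = 0 := rfl
  rw [this, map_zero h.infiniteSum, map_zero W.ad, add_zero]
  rfl

/-- Since `E` ignores `W.ad`, shifting a class to the right does not change its infinite sum. -/
theorem Orthogonal.infiniteSum_comp_nullShift (h : V.Orthogonal W) :
    h.infiniteSum.comp (nullShift Y) = W.ad.comp h.infiniteSum := by
  ext a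
  rw [NonUnitalStarAlgHom.comp_apply, h.infiniteSum_eq]
  have h₀ : nullShift Y a 0 = 0 := rfl
  have h₁ : nullTail Y (nullShift Y a) = a := rfl
  rw [h₀, h₁, map_zero, zero_add, NonUnitalStarAlgHom.comp_apply]

end IsometricMultiplier

end NullSequences

end

noncomputable section

/-! ### The split extension associated with a sequence of `⋆`-homomorphisms -/

section SequenceExtension

variable {X Y Z : Type u} [NonUnitalCStarAlgebra X] [NonUnitalCStarAlgebra Y]
  [NonUnitalCStarAlgebra Z]

/-- The `⋆`-homomorphism into bounded sequences with prescribed coordinates. -/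
def boundedLift (f : ℕ → Z →⋆ₙₐ[ℂ] Y) : Z →⋆ₙₐ[ℂ] (ℕ →ᵇ Y) where
  toFun z := BoundedContinuousFunction.ofNormedAddCommGroup (fun n => f n z)
    continuous_of_discreteTopology ‖z‖ fun n => NonUnitalStarAlgHom.norm_apply_le (f n) z
  map_smul' c z := BoundedContinuousFunction.ext fun n => map_smul (f n) c z
  map_zero' := BoundedContinuousFunction.ext fun n => map_zero (f n)
  map_add' x y := BoundedContinuousFunction.ext fun n => map_add (f n) x y
  map_mul' x y := BoundedContinuousFunction.ext fun n => map_mul (f n) x y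
  map_star' z := BoundedContinuousFunction.ext fun n => map_star (f n) z

/-- The pairs `(x, d)` of `x : X` and a bounded sequence `d` in `Y` with `d n - α n x → 0`. -/
def sequenceExtension (α : ℕ → X →⋆ₙₐ[ℂ] Y) : NonUnitalStarSubalgebra ℂ (X × (ℕ →ᵇ Y)) where
  carrier := {p | Tendsto (fun n => p.2 n - α n p.1) atTop (𝓝 0)}
  zero_mem' := by simp
  add_mem' {p q} hp hq := by
    refine (add_zero (0 : Y) ▸ Tendsto.add hp hq).congr fun n => ?_
    simp only [Prod.fst_add, Prod.snd_add, BoundedContinuousFunction.add_apply, map_add]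
    abel
  smul_mem' c p hp := by
    refine (smul_zero (A := Y) c ▸ Tendsto.const_smul hp c).congr fun n => ?_
    simp only [Prod.smul_fst, Prod.smul_snd, BoundedContinuousFunction.smul_apply, map_smul,
      smul_sub]
  mul_mem' {p q} hp hq := by
    -- Null times bounded and bounded times null, from `d d' - α(x) α(x') = (d - α(x)) d' + α(x) (d'
    -- - α(x'))`.
    have h₁ : Tendsto (fun n => (p.2 n - α n p.1) * q.2 n) atTop (𝓝 0) :=
      Tendsto.zero_mul_isBoundedUnder_le hp
        ⟨‖q.2‖, eventually_map.2 (.of_forall fun n => q.2.norm_coe_le_norm n)⟩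
    have h₂ : Tendsto (fun n => α n p.1 * (q.2 n - α n q.1)) atTop (𝓝 0) :=
      isBoundedUnder_le_mul_tendsto_zero
        ⟨‖p.1‖, eventually_map.2 (.of_forall fun n => NonUnitalStarAlgHom.norm_apply_le (α n) p.1)⟩
        hq
    refine (add_zero (0 : Y) ▸ h₁.add h₂).congr fun n => ?_
    simp only [Prod.fst_mul, Prod.snd_mul, BoundedContinuousFunction.mul_apply, map_mul, sub_mul,
      mul_sub]
    abel
  star_mem' {p} hp := by
    refine (star_zero Y ▸ Tendsto.star hp).congr fun n => ?_
    simp only [Prod.fst_star, Prod.snd_star, BoundedContinuousFunction.star_apply, map_star,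
      star_sub]

variable {α β : ℕ → X →⋆ₙₐ[ℂ] Y}

theorem mem_sequenceExtension {p : X × (ℕ →ᵇ Y)} :
    p ∈ sequenceExtension α ↔ Tendsto (fun n => p.2 n - α n p.1) atTop (𝓝 0) := Iff.rfl

/-- Closedness makes the extension a C⋆-algebra, so that `E` applies to it. -/
instance : IsClosed (sequenceExtension α : Set (X × (ℕ →ᵇ Y))) := by
  refine isClosed_of_closure_subset fun p hp => NormedAddGroup.tendsto_nhds_zero.2 fun ε hε => ?_
  obtain ⟨q, hq, hpq⟩ := Metric.mem_closure_iff.1 hp (ε / 3) (by positivity)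
  rw [dist_eq_norm] at hpq
  have hlim := NormedAddGroup.tendsto_nhds_zero.1 (mem_sequenceExtension.1 hq) (ε / 3)
    (by positivity)
  filter_upwards [hlim] with n hn
  have h₁ : ‖(p - q).2 n‖ ≤ ‖p - q‖ :=
    ((p - q).2.norm_coe_le_norm n).trans (norm_snd_le (p - q))
  have h₂ : ‖α n (p - q).1‖ ≤ ‖p - q‖ :=
    (NonUnitalStarAlgHom.norm_apply_le (α n) _).trans (norm_fst_le (p - q))
  have h₃ : p.2 n - α n p.1 = (q.2 n - α n q.1) + (p - q).2 n - α n (p - q).1 := by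
    simp only [Prod.fst_sub, Prod.snd_sub, BoundedContinuousFunction.sub_apply, map_sub]
    abel
  rw [h₃]
  have h₄ := norm_sub_le ((q.2 n - α n q.1) + (p - q).2 n) (α n (p - q).1)
  have h₅ := norm_add_le (q.2 n - α n q.1) ((p - q).2 n)
  linarith

namespace sequenceExtension

/-- The quotient map `(x, d) ↦ x`. -/
def base (α : ℕ → X →⋆ₙₐ[ℂ] Y) : sequenceExtension α →⋆ₙₐ[ℂ] X :=
  (NonUnitalStarAlgHom.fst ℂ X (ℕ →ᵇ Y)).comp
    (NonUnitalStarSubalgebraClass.subtype (sequenceExtension α))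

/-- The coordinate map `(x, d) ↦ d n`. -/
def coord (α : ℕ → X →⋆ₙₐ[ℂ] Y) (n : ℕ) : sequenceExtension α →⋆ₙₐ[ℂ] Y where
  toFun p := p.1.2 n
  map_smul' _ _ := rfl
  map_zero' := rfl
  map_add' _ _ := rfl
  map_mul' _ _ := rfl
  map_star' _ := rfl

theorem tendsto_coord_sub (p : sequenceExtension α) :
    Tendsto (fun n => coord α n p - α n (base α p)) atTop (𝓝 0) := p.2

theorem ext_coord {p q : sequenceExtension α} (h : base α p = base α q)
    (h' : ∀ n, coord α n p = coord α n q) : p = q :=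
  Subtype.ext (Prod.ext h (BoundedContinuousFunction.ext h'))

/-- The `⋆`-homomorphism into the extension with prescribed components. -/
def lift (g : Z →⋆ₙₐ[ℂ] X) (f : ℕ → Z →⋆ₙₐ[ℂ] Y)
    (h : ∀ z, Tendsto (fun n => f n z - α n (g z)) atTop (𝓝 0)) :
    Z →⋆ₙₐ[ℂ] sequenceExtension α :=
  NonUnitalStarAlgHom.codRestrict (g.prod (boundedLift f)) (sequenceExtension α) h

/-- The inclusion of the ideal of null sequences. -/
def ofNull (α : ℕ → X →⋆ₙₐ[ℂ] Y) : C₀(ℕ, Y) →⋆ₙₐ[ℂ] sequenceExtension α :=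
  lift 0 (nullEval Y) fun a => by
    simpa only [NonUnitalStarAlgHom.zero_apply, map_zero, sub_zero, nullEval_apply]
      using tendsto_zeroAtInfty_nat a

/-- The section defined by a sequence of `⋆`-homomorphisms asymptotic to `α`. -/
def liftSection (β : ℕ → X →⋆ₙₐ[ℂ] Y) (h : ∀ x, Tendsto (fun n => β n x - α n x) atTop (𝓝 0)) :
    X →⋆ₙₐ[ℂ] sequenceExtension α :=
  lift (NonUnitalStarAlgHom.id ℂ X) β h

theorem base_comp_liftSection (h) :
    (base α).comp (liftSection β h) = NonUnitalStarAlgHom.id ℂ X := rfl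

theorem ofNull_injective : Function.Injective (ofNull α) := fun _ _ h =>
  ZeroAtInftyContinuousMap.ext fun n => congrArg (coord α n) h

theorem exact_ofNull_base : Function.Exact (ofNull α) (base α) := fun p =>
  ⟨fun h => by
    have hp : Tendsto (fun n => coord α n p) atTop (𝓝 0) := by
      simpa only [h, map_zero, sub_zero] using tendsto_coord_sub p
    exact ⟨⟨⟨fun n => coord α n p, continuous_of_discreteTopology⟩,
      by simpa only [cocompact_eq_cofinite, Nat.cofinite_eq_atTop] using hp⟩,
      ext_coord h.symm fun n => rfl⟩, by rintro ⟨a, rfl⟩; rfl⟩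

variable {E : CStarAlgCat.{u} ⥤ AddCommGrpCat.{v}}

theorem tendsto_sub_self (x : X) : Tendsto (fun n => α n x - α n x) atTop (𝓝 0) := by
  simp only [sub_self, tendsto_const_nhds]

/-- The sequence `α` is itself a section, so the extension always splits. Injectivity allows
identities between classes of null sequences to be checked in the extension. -/
theorem map_ofNull_injective (hE : IsSplitExact E) :
    Function.Injective (functorMap E (ofNull α)) :=
  (hE _ _ _ (ofNull α) (base α) (liftSection α tendsto_sub_self) ofNull_injective
    exact_ofNull_base (base_comp_liftSection _)).1

/-- The class of a quasihomomorphism: two sections of the extension differ by an element coming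
from null sequences. -/
theorem exists_map_ofNull_eq_sub (hE : IsSplitExact E) {β γ : ℕ → X →⋆ₙₐ[ℂ] Y} (hβ) (hγ)
    (ξ : E.obj (.of X)) : ∃ u, functorMap E (ofNull α) u =
      functorMap E (liftSection β hβ) ξ - functorMap E (liftSection γ hγ) ξ := by
  refine ((hE _ _ _ (ofNull α) (base α) (liftSection α tendsto_sub_self) ofNull_injective
    exact_ofNull_base (base_comp_liftSection _)).2.1 _).1 ?_
  change functorMap E (base α) _ = 0
  rw [map_sub, functorMap_comp, functorMap_comp, base_comp_liftSection, base_comp_liftSection,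
    sub_self]

end sequenceExtension

/-! ### Shift invariance of the difference class, and dyadic subdivision -/

open sequenceExtension

/-- The key step: if the sequences `φ`, `o`, `ψ` are asymptotic to each other and
`φ (n + 1) = φ n ⊕ o n`, `ψ (n + 1) = o n ⊕ ψ n`, then `E` cannot distinguish `φ 0` and `ψ 0`. -/
theorem functorMap_eq_of_asymptotic {E : CStarAlgCat.{u} ⥤ AddCommGrpCat.{v}}
    (hM : IsM2Stable E) (hE : IsSplitExact E) {V W : IsometricMultiplier Y} (h : V.Orthogonal W)
    {φ o ψ : ℕ → X →⋆ₙₐ[ℂ] Y}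
    (ho : ∀ x, Tendsto (fun n => o n x - φ n x) atTop (𝓝 0))
    (hψ : ∀ x, Tendsto (fun n => ψ n x - φ n x) atTop (𝓝 0))
    (hφs : ∀ n, φ (n + 1) = h.adSum.comp ((φ n).prod (o n)))
    (hψs : ∀ n, ψ (n + 1) = h.adSum.comp ((o n).prod (ψ n))) (ξ : E.obj (.of X)) :
    functorMap E (φ 0) ξ = functorMap E (ψ 0) ξ := by
  have hcont : Continuous h.adSum := AddMonoidHomClass.continuous_of_bound h.adSum 1 fun y => by
    simpa using NonUnitalStarAlgHom.norm_apply_le h.adSum y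
  have hsum {a b c d : ℕ → Y} (hac : Tendsto (fun n => a n - c n) atTop (𝓝 0))
      (hbd : Tendsto (fun n => b n - d n) atTop (𝓝 0)) :
      Tendsto (fun n => h.adSum (a n, b n) - h.adSum (c n, d n)) atTop (𝓝 0) := by
    have := (hcont.tendsto (0, 0)).comp (hac.prodMk_nhds hbd)
    rw [show ((0 : Y), (0 : Y)) = 0 from rfl, map_zero] at this
    exact this.congr fun n => map_sub h.adSum (a n, b n) (c n, d n)
  have hself (f : ℕ → Y) : Tendsto (fun n => f n - f n) atTop (𝓝 0) := by
    simp only [sub_self, tendsto_const_nhds]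
  have hφ : ∀ x, Tendsto (fun n => φ n x - φ n x) atTop (𝓝 0) := fun x => hself _
  let φ' : ℕ → X →⋆ₙₐ[ℂ] Y := fun n => φ (n + 1)
  have hφ'x (n : ℕ) (x : X) : φ' n x = h.adSum (φ n x, o n x) := by
    change φ (n + 1) x = _
    rw [hφs]; rfl
  have hψ'x (n : ℕ) (x : X) : ψ (n + 1) x = h.adSum (o n x, ψ n x) := by
    rw [hψs]; rfl
  -- The class of `φ - ψ` is kept as the sum of the classes of `φ - o` and `o - ψ`, because the
  -- shift will conjugate the first by `V` and the second by `W`.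
  obtain ⟨y₁, hy₁⟩ := exists_map_ofNull_eq_sub hE hφ ho ξ
  obtain ⟨y₂, hy₂⟩ := exists_map_ofNull_eq_sub hE ho hψ ξ
  have hy : functorMap E (ofNull φ) (y₁ + y₂) =
      functorMap E (liftSection φ hφ) ξ - functorMap E (liftSection ψ hψ) ξ := by
    rw [map_add, hy₁, hy₂, sub_add_sub_cancel]
  have h₀ : functorMap E (nullEval Y 0) (y₁ + y₂) =
      functorMap E (φ 0) ξ - functorMap E (ψ 0) ξ := by
    have := congrArg (functorMap E (coord φ 0)) hy
    rw [functorMap_comp, map_sub, functorMap_comp, functorMap_comp] at this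
    exact this
  -- Deleting the first coordinate lands in the extension of the shifted sequence `φ'`. The maps
  -- `F₁` and `F₂` below have the same target: they add `o` of the base point on the right and on
  -- the left. `T` agrees with `F₁` on the section `φ` and with `F₂` on `ψ`, while `F₁` and `F₂`
  -- agree on `o`.
  let T : sequenceExtension φ →⋆ₙₐ[ℂ] sequenceExtension φ' :=
    lift (base φ) (fun n => coord φ (n + 1))
      fun p => (tendsto_coord_sub p).comp (tendsto_add_atTop_nat 1)
  let F₁ : sequenceExtension φ →⋆ₙₐ[ℂ] sequenceExtension φ' :=
    lift (base φ) (fun n => h.adSum.comp ((coord φ n).prod ((o n).comp (base φ)))) fun p => by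
      simp only [hφ'x]
      exact hsum (tendsto_coord_sub p) (hself _)
  let F₂ : sequenceExtension φ →⋆ₙₐ[ℂ] sequenceExtension φ' :=
    lift (base φ) (fun n => h.adSum.comp (((o n).comp (base φ)).prod (coord φ n))) fun p => by
      simp only [hφ'x]
      -- The target sequence is `φ n ⊕ o n`, so here `o n` must approximate `φ n` on the left, and
      -- the coordinates `d n` must approximate `o n` on the right.
      refine hsum (ho _) ?_
      simpa using (tendsto_coord_sub p).sub (ho (base φ p))
  have hT : T.comp (ofNull φ) = (ofNull φ').comp (nullTail Y) := rfl
  -- Null sequences lie over the base point `0`, so the added summand vanishes and only entrywise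
  -- conjugation is left.
  have hF₁ : F₁.comp (ofNull φ) = (ofNull φ').comp V.null.ad := by
    ext1 a
    refine ext_coord rfl fun n => ?_
    change h.adSum (a n, o n 0) = V.ad (a n)
    rw [map_zero, h.adSum_apply, map_zero, add_zero]
  have hF₂ : F₂.comp (ofNull φ) = (ofNull φ').comp W.null.ad := by
    ext1 a
    refine ext_coord rfl fun n => ?_
    change h.adSum (o n 0, a n) = W.ad (a n)
    rw [map_zero, h.adSum_apply, map_zero, zero_add]
  have hTφ : T.comp (liftSection φ hφ) = F₁.comp (liftSection φ hφ) := by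
    ext1 x
    refine ext_coord rfl fun n => ?_
    change φ (n + 1) x = h.adSum (φ n x, o n x)
    exact hφ'x n x
  have hTψ : T.comp (liftSection ψ hψ) = F₂.comp (liftSection ψ hψ) := by
    ext1 x
    refine ext_coord rfl fun n => ?_
    change ψ (n + 1) x = h.adSum (o n x, ψ n x)
    exact hψ'x n x
  have hF : F₁.comp (liftSection o ho) = F₂.comp (liftSection o ho) := by
    ext1 x
    refine ext_coord rfl fun n => ?_
    change h.adSum (o n x, o n x) = h.adSum (o n x, o n x)
    rfl
  -- The shift sends `φ - ψ` to `F₁ φ - F₂ ψ = F₁ (φ - o) + F₂ (o - ψ)`, the middle terms cancelling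
  -- by `hF`; on null sequences `F₁` and `F₂` are inner, hence invisible to `E`.
  have htail : functorMap E (nullTail Y) (y₁ + y₂) = y₁ + y₂ := by
    apply map_ofNull_injective (α := φ') hE
    calc functorMap E (ofNull φ') (functorMap E (nullTail Y) (y₁ + y₂))
        = functorMap E T (functorMap E (ofNull φ) (y₁ + y₂)) := by
          rw [functorMap_comp, functorMap_comp, hT]
      _ = functorMap E F₁ (functorMap E (ofNull φ) y₁)
          + functorMap E F₂ (functorMap E (ofNull φ) y₂) := by
        rw [hy, hy₁, hy₂, map_sub, map_sub, map_sub]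
        simp only [functorMap_comp]
        rw [hTφ, hTψ, hF, sub_add_sub_cancel]
      _ = functorMap E (ofNull φ') (y₁ + y₂) := by
        rw [functorMap_comp, functorMap_comp, hF₁, hF₂, ← functorMap_comp, ← functorMap_comp,
          hM.map_ad, hM.map_ad, map_add]
  generalize y₁ + y₂ = y at htail h₀
  -- The swindle: with the tail of `y` equal to `y`, the infinite sum of `y` equals itself plus the
  -- entry of `y` at `0`.
  have key := congrArg (functorMap E h.infiniteSum) (hE.eq_single_add_shift y)
  rw [htail, map_add, functorMap_comp h.infiniteSum (nullSingle Y),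
    functorMap_comp h.infiniteSum (nullShift Y), h.infiniteSum_comp_nullSingle,
    h.infiniteSum_comp_nullShift, ← functorMap_comp W.ad, hM.map_ad, hM.map_ad, h₀,
    right_eq_add] at key
  exact sub_eq_zero.1 key

/-- Higson's theorem for algebras with two orthogonal isometric multipliers. -/
theorem functorMap_eq_of_uniformContinuous {E : CStarAlgCat.{u} ⥤ AddCommGrpCat.{v}}
    (hM : IsM2Stable E) (hE : IsSplitExact E) {V W : IsometricMultiplier Y} (h : V.Orthogonal W)
    {θ : ℝ → X →⋆ₙₐ[ℂ] Y} (hθ : ∀ x, UniformContinuous fun r => θ r x) (ξ : E.obj (.of X)) :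
    functorMap E (θ 0) ξ = functorMap E (θ 1) ξ := by
  have hpow (n : ℕ) : (0 : ℝ) < 2 ^ n := by positivity
  have := functorMap_eq_of_asymptotic hM hE h
    (φ := fun n => h.dyadicSum n fun i => θ (i / 2 ^ n))
    (o := fun n => h.dyadicSum n fun i => θ ((2 * i + 1) / 2 ^ (n + 1)))
    (ψ := fun n => h.dyadicSum n fun i => θ ((i + 1) / 2 ^ n))
    (h.tendsto_dyadicSum_sub hθ fun n i => by
      have : ((2 * i + 1) / 2 ^ (n + 1) - i / 2 ^ n : ℝ) = (1 / 2) ^ n * (1 / 2) := by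
        rw [one_div_pow]; field_simp; ring
      rw [this, abs_of_nonneg (by positivity)]
      exact mul_le_of_le_one_right (by positivity) (by norm_num))
    (h.tendsto_dyadicSum_sub hθ fun n i => by
      have : ((i + 1) / 2 ^ n - i / 2 ^ n : ℝ) = (1 / 2) ^ n := by
        rw [one_div_pow]; field_simp; ring
      rw [this, abs_of_nonneg (by positivity)])
    -- At level `n + 1` the even left endpoints are the left endpoints of level `n` and the odd ones
    -- its midpoints. For right endpoints the even indices give the midpoints and the odd ones the
    -- old right endpoints, hence the reversed order of the sum.
    (fun n => by
      have h₁ (i : ℕ) : (((2 * i : ℕ) : ℝ) / 2 ^ (n + 1)) = i / 2 ^ n := by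
        push_cast; field_simp; ring
      simp only [IsometricMultiplier.Orthogonal.dyadicSum, h₁]
      push_cast; rfl)
    (fun n => by
      have h₁ (i : ℕ) : (((2 * i + 1 : ℕ) : ℝ) + 1) / 2 ^ (n + 1) = (i + 1) / 2 ^ n := by
        push_cast; field_simp; ring
      simp only [IsometricMultiplier.Orthogonal.dyadicSum, h₁]
      push_cast; rfl) ξ
  -- At level `0` there is a single interval, with endpoints `0` and `1`.
  simpa [IsometricMultiplier.Orthogonal.dyadicSum] using this

end SequenceExtension

end

/-! ### Homotopy invariance after tensoring with `O` -/

theorem corollary2p3 (E : CStarAlgCat.{u} ⥤ AddCommGrpCat.{v}) (hM : IsM2Stable E)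
    (hE : IsSplitExact E) (O : Type u) [CStarAlgebra O] (hO : IsProperlyInfinite O) :
    IsHomotopyInvariant (CStarAlgCat.tensorRight O ⋙ E) := by
  obtain ⟨s, t, hs, ht, hst⟩ := hO
  rintro A B _ _ _ _ ⟨Φ, hΦ, rfl, rfl⟩
  have hVW : (SpatialTensor.isometricMultiplier B s hs).Orthogonal
      (SpatialTensor.isometricMultiplier B t ht) :=
    SpatialTensor.star_isometricMultiplier_mul hs ht hst
  -- Clamping the parameter to `[0, 1]` gives a family on all of `ℝ`, as the dyadic sums are indexed
  -- by unrestricted `i`. It stays uniformly continuous, since `[0, 1]` is compact and the clamping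
  -- is Lipschitz.
  let θ (r : ℝ) := SpatialTensor.map (Φ (Set.projIcc 0 1 zero_le_one r))
    (NonUnitalStarAlgHom.id ℂ O)
  have hθ (x : SpatialTensor A O) : UniformContinuous fun r => θ r x :=
    (CompactSpace.uniformContinuous_of_continuous
      (SpatialTensor.continuous_map_apply hΦ x)).comp
        (LipschitzWith.projIcc zero_le_one).uniformContinuous
  have key := functorMap_eq_of_uniformContinuous hM hE hVW hθ
  simp only [θ, Set.projIcc_left, Set.projIcc_right] at key
  ext ξ
  exact key ξ
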